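/- Let $(\alpha_i)_{i\ge 1}$ be a sequence in $[0,\infty]$. For $n\ge 1$ put $p_i=n^{-\alpha_i}$ (with $n^{-\infty}=0$), and let $X([n],\mathbf p)$ be the multiparameter random simplicial complex on $[n]=\{1,\dots,n\}$: all $n$ vertices are present and, recursively for $i=1,2,\dots,n-1$, each potential $i$-face whose boundary $(i-1)$-faces are all present is added with probability $p_i$, independently of all other potential faces. Put $$\psi_j=\sum_{i=1}^j\binom{j}{i}\alpha_i\ (j\ge 1),\qquad \tau_j=j+1-\sum_{i=1}^j\psi_i\ (j\ge 0),\qquad q=\min\{i\ge1:\alpha_i>0\},$$ and assume that there is a critical dimension $k$, that is, an integer $k\ge q$ with $\psi_k<1<\psi_{k+1}$. Fix $m\ge k+1$ and assume that $\tau_{m+1}+\alpha_{m+1}>0$ and $\alpha_{m+1}\in(0,\infty)$. For every $n$ let $X_n$ be a random complex with the law of $X([n],\mathbf p)$, all of them defined on one probability space (with an arbitrary joint law), and let $\beta_{m,n}=\dim H_m(X_n;\mathbb F)$ be the $m$-th Betti number of $X_n$, with coefficients in an arbitrary field $\mathbb F$ (for example $\mathbb F=\mathbb Q$). Then, as $n\to\infty$,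 $$\frac{\beta_{m,n}}{n^{\tau_{m+1}+\alpha_{m+1}}}\longrightarrow\frac{1}{(m+2)!}\qquad\text{almost surely.}$$ -/

import Mathlib

open Filter Topology MeasureTheory ProbabilityTheory
open scoped ENNReal

namespace MultiparamComplex

noncomputable section

/-! ## Simplicial homology of an abstract simplicial complex on an ordered vertex set -/

section Homology

variable {V : Type*} [LinearOrder V]

/-- The `d`-dimensional faces of `K`: the faces with `d + 1` vertices. -/
abbrev Face (K : AbstractSimplicialComplex V) (d : ℕ) : Type _ :=
  {s : Finset V // s ∈ K ∧ s.card = d + 1}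

/-- The facet of a `(d+1)`-face obtained by deleting one of its vertices. -/
def Face.delete {K : AbstractSimplicialComplex V} {d : ℕ} (s : Face K (d + 1))
    (v : {x // x ∈ s.1}) : Face K d :=
  ⟨s.1.erase v.1, by
    have hcard : (s.1.erase v.1).card = d + 1 := by
      rw [Finset.card_erase_of_mem v.2, s.2.2]; rfl
    exact ⟨(K.isRelLowerSet_faces s.2.1).2 (Finset.erase_subset _ _)
      (Finset.card_pos.1 (by omega)), hcard⟩⟩

variable (𝕜 : Type*) [Field 𝕜] (K : AbstractSimplicialComplex V)

/-- Simplicial `d`-chains of `K` with coefficients in `𝕜`. Each face is oriented by the order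
of the vertices. -/
abbrev Chain (d : ℕ) : Type _ := Face K d →₀ 𝕜

/-- The simplicial boundary map: a face `v₀ < v₁ < ⋯ < v_{d+1}` is sent to the sum over `i` of
`(-1)^i` times the face with `v_i` deleted. The index `i` of a vertex is the number of vertices
of the face which precede it. -/
def boundary (d : ℕ) : Chain 𝕜 K (d + 1) →ₗ[𝕜] Chain 𝕜 K d :=
  Finsupp.linearCombination 𝕜 fun s : Face K (d + 1) =>
    ∑ v ∈ s.1.attach, Finsupp.single (s.delete v) ((-1 : 𝕜) ^ (s.1.filter (· < v.1)).card)

/-- The space of `d`-cycles; every `0`-chain is a cycle (unreduced homology). -/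
def cycles : (d : ℕ) → Submodule 𝕜 (Chain 𝕜 K d)
  | 0 => ⊤
  | d + 1 => LinearMap.ker (boundary 𝕜 K d)

/-- The space of `d`-boundaries. -/
def boundaries (d : ℕ) : Submodule 𝕜 (Chain 𝕜 K d) := LinearMap.range (boundary 𝕜 K d)

/-- The quotient `Z / B` of two subspaces `B ≤ Z` of a vector space. -/
abbrev Subquotient {𝕜 M : Type*} [Field 𝕜] [AddCommGroup M] [Module 𝕜 M]
    (Z B : Submodule 𝕜 M) : Type _ :=
  Z ⧸ B.submoduleOf Z

/-- The `d`-th simplicial homology of `K`: cycles modulo boundaries. -/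
abbrev Homology (d : ℕ) : Type _ := Subquotient (cycles 𝕜 K d) (boundaries 𝕜 K d)

/-- The `d`-th Betti number of `K`: the dimension over `𝕜` of the `d`-th homology. -/
def betti (d : ℕ) : ℕ := Module.finrank 𝕜 (Homology 𝕜 K d)

end Homology

/-! ## The multiparameter random simplicial complex -/

/-- The complex built from the outcomes of the coin tosses `c` attached to the potential faces.
All vertices are present, and a set `s` of at least two vertices is a face exactly when all its
proper nonempty subsets are faces and the coin of `s` shows `true`; unfolding this recursion, `s`
is a face when the coin of every subset of `s` with at least two elements shows `true`. -/
def complexOfCoins {n : ℕ} (c : Finset (Fin n) → Bool) : AbstractSimplicialComplex (Fin n) where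
  faces := {s | s.Nonempty ∧ ∀ t ⊆ s, 2 ≤ t.card → c t = true}
  isRelLowerSet_faces := fun _ hs =>
    ⟨hs.1, fun _ hts ht => ⟨ht, fun u hu => hs.2 u (hu.trans hts)⟩⟩
  singleton_mem := fun v => ⟨Finset.singleton_nonempty v, fun t ht h2 => by
    have := Finset.card_le_card ht
    rw [Finset.card_singleton] at this
    omega⟩

/-- The recursive description of the complex: `s` is added, given its whole boundary, according
to its own coin. -/
theorem mem_complexOfCoins_iff {n : ℕ} (c : Finset (Fin n) → Bool) (s : Finset (Fin n))
    (hs : 2 ≤ s.card) :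
    s ∈ complexOfCoins c ↔
      (∀ t ⊂ s, t.Nonempty → t ∈ complexOfCoins c) ∧ c s = true := by
  constructor
  · intro h
    exact ⟨fun t ht hne => ((complexOfCoins c).isRelLowerSet_faces h).2 ht.subset hne,
      h.2 s (Finset.Subset.refl s) hs⟩
  · rintro ⟨h1, h2⟩
    refine ⟨Finset.card_pos.1 (by omega), fun t ht htc => ?_⟩
    rcases eq_or_ne t s with rfl | hne
    · exact h2
    · exact (h1 t (ht.ssubset_of_ne hne) (Finset.card_pos.1 (by omega))).2 t
        (Finset.Subset.refl t) htc

/-- Every set of complexes on the finite vertex set is an event. -/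
instance (n : ℕ) : MeasurableSpace (AbstractSimplicialComplex (Fin n)) := ⊤

/-- The law of the multiparameter random simplicial complex `X([n], p)`: the coins of the
potential faces are independent, and the coin of a potential `i`-face shows `true` with
probability `p i`. (The coins of sets with fewer than two elements are not used.) -/
def complexLaw (n : ℕ) (p : ℕ → unitInterval) : Measure (AbstractSimplicialComplex (Fin n)) :=
  (Measure.pi fun s : Finset (Fin n) => bernoulliMeasure true false (p (s.card - 1))).map
    complexOfCoins

/-- The connectivity probability `n ^ (-a)` for `a ∈ [0, ∞]`, with `n ^ (-∞) = 0`. -/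
def connProb (n : ℕ) (a : ℝ≥0∞) : unitInterval :=
  ⟨if a = ∞ then 0 else (n : ℝ) ^ (-a.toReal), by
    split_ifs
    · simp
    · refine ⟨by positivity, ?_⟩
      rcases Nat.eq_zero_or_pos n with rfl | hn
      · simpa using Real.zero_rpow_le_one (-a.toReal)
      · exact Real.rpow_le_one_of_one_le_of_nonpos (by exact_mod_cast hn) (by simp)⟩

/-! ## The parameters

The sequence `α` is indexed by the dimensions `i ≥ 1`; the value `α 0` plays no role. -/

/-- `ψ_j = ∑_{i=1}^j (j choose i) α_i`. -/
def psi (α : ℕ → ℝ≥0∞) (j : ℕ) : ℝ≥0∞ :=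
  ∑ i ∈ Finset.Icc 1 j, (j.choose i : ℝ≥0∞) * α i

/-- `τ_j = j + 1 - ∑_{i=1}^j ψ_i`, which may be `-∞`. -/
def tau (α : ℕ → ℝ≥0∞) (j : ℕ) : EReal :=
  ((j : ℝ) + 1 : ℝ) - ((∑ i ∈ Finset.Icc 1 j, psi α i : ℝ≥0∞) : EReal)

/-- `q`, the least dimension `i ≥ 1` with `α_i > 0`. -/
def firstPos (α : ℕ → ℝ≥0∞) : ℕ := sInf {i | 1 ≤ i ∧ 0 < α i}

/-- `k` is the critical dimension: `k ≥ q` and `ψ_k < 1 < ψ_{k+1}`. As `ψ` is monotone, `ψ_q > 0`,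
and `ψ` is strictly increasing from `q` on as long as it is finite, this yields
`0 < ψ_q < ⋯ < ψ_k < 1 < ψ_{k+1} < ⋯`. -/
structure IsCriticalDim (α : ℕ → ℝ≥0∞) (k : ℕ) : Prop where
  firstPos_le : firstPos α ≤ k
  psi_lt_one : psi α k < 1
  one_lt_psi : 1 < psi α (k + 1)

end

end MultiparamComplex

/-! Give a face with `j` vertices the cost `b j`, equal to `α (j - 1)` for `j ≥ 2` and to `0`
otherwise. A configuration with `v` vertices and total cost `w` has about `n ^ (v - w)` expected
copies. The exponent `e = τ_{m+1} + α_{m+1}` is that of the boundary of an `(m + 1)`-simplex, a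
"hollow simplex", filled or not. The mean number of present hollow simplices is `(n choose m+2) n ^
(e - m - 2)`, asymptotic to `n ^ e / (m+2)!`, and the Betti number turns out to be asymptotic to
their number.

Deterministic half. In the support of an `m`-cycle no ridge lies in exactly one face. A strongly
connected component of such a support is a hollow simplex or has at least `m + 3` vertices; the
latter is called a bad family. Evaluating cycles at one facet of each hollow simplex and at all
faces of bad families bounds the dimension of the cycle space from above. Hollow simplices sharing
no facet with another one give independent cycles, which bounds it from below. The boundaries have
dimension at most the number of `(m + 1)`-faces. Hence the error is controlled by bad families and
filled simplices (`abs_betti_sub_card_hollowSets_le`).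

Probabilistic half. Joining a new vertex to a simplex with `j` vertices costs `ψ_j` (`joinCost`). As
`ψ_m > 1`, every vertex beyond the necessary ones lowers the exponent. Moments involve overlapping
copies, so exponents are bounded relative to an arbitrary set `W` of vertices already in use
(`CostData.exponent_cases`). Bad families, filled simplices and hollow simplices touching `W` all
fall short of `e` by a fixed `δ > 0`. High moments (`integral_ind_mul_pow_le`) and high centered
moments (`integral_centered_pow_le`) then give tails of order `n ^ (-2)`, and the first
Borel–Cantelli lemma, which needs no independence between different `n`, gives almost sure
convergence (`ae_tendsto_zero`). Strongly connected families on some large fixed number of vertices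
have exponent at most `-2`, so they eventually disappear; this bounds the size of the bad families
that matter. -/

namespace MultiparamComplex

/-! ### Set families, ridges and links. -/

section Families

open Finset

variable {V : Type*} [DecidableEq V]

/-- The faces generated by a family of sets. -/
def subfaces (C : Finset (Finset V)) : Finset (Finset V) := C.biUnion powerset

/-- The vertices of a family of sets. -/
def verts (C : Finset (Finset V)) : Finset V := C.biUnion id

/-- Every ridge of the family lies in at least two of its members. -/
def RidgeCyclic (C : Finset (Finset V)) : Prop :=
  ∀ F ∈ C, ∀ y ∈ F, ∃ G ∈ C, G ≠ F ∧ F.erase y ⊆ G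

/-- Any two members are joined by a chain of members, consecutive ones sharing `m` vertices. -/
def StronglyConnected (m : ℕ) (C : Finset (Finset V)) : Prop :=
  ∀ D ⊆ C, D.Nonempty → (∀ F ∈ D, ∀ G ∈ C, m ≤ #(F ∩ G) → G ∈ D) → D = C

theorem mem_subfaces {C : Finset (Finset V)} {s : Finset V} :
    s ∈ subfaces C ↔ ∃ F ∈ C, s ⊆ F := by
  simp [subfaces]

theorem mem_verts {C : Finset (Finset V)} {v : V} : v ∈ verts C ↔ ∃ F ∈ C, v ∈ F := by
  simp [verts]

theorem subset_verts {C : Finset (Finset V)} {F : Finset V} (hF : F ∈ C) : F ⊆ verts C :=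
  fun _ hv => mem_verts.2 ⟨F, hF, hv⟩

theorem subset_verts_of_mem_subfaces {C : Finset (Finset V)} {s : Finset V}
    (hs : s ∈ subfaces C) : s ⊆ verts C := by
  obtain ⟨F, hF, h⟩ := mem_subfaces.1 hs
  exact h.trans (subset_verts hF)

theorem subfaces_union (C D : Finset (Finset V)) :
    subfaces (C ∪ D) = subfaces C ∪ subfaces D := by
  ext s; simp only [mem_subfaces, mem_union]; grind

theorem verts_union (C D : Finset (Finset V)) : verts (C ∪ D) = verts C ∪ verts D := by
  ext s; simp only [mem_verts, mem_union]; grind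

/-- The link of a vertex in a family of sets. -/
def link (C : Finset (Finset V)) (v : V) : Finset (Finset V) :=
  {F ∈ C | v ∈ F}.image (·.erase v)

theorem mem_link {C : Finset (Finset V)} {v : V} {G : Finset V} :
    G ∈ link C v ↔ ∃ F ∈ C, v ∈ F ∧ F.erase v = G := by
  simp [link, and_assoc]

theorem RidgeCyclic.link {C : Finset (Finset V)} (hC : RidgeCyclic C) (v : V) :
    RidgeCyclic (link C v) := by
  intro G hG y hy
  obtain ⟨F, hF, hv, rfl⟩ := mem_link.1 hG
  have hyv : y ≠ v := (mem_erase.1 hy).1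
  obtain ⟨F', hF', hne, hsub⟩ := hC F hF y (mem_erase.1 hy).2
  have hv' : v ∈ F' := hsub (mem_erase.2 ⟨hyv.symm, hv⟩)
  refine ⟨F'.erase v, mem_link.2 ⟨F', hF', hv', rfl⟩, fun h => hne ?_, ?_⟩
  · rw [← insert_erase hv', h, insert_erase hv]
  · rw [erase_right_comm]; exact erase_subset_erase v hsub

theorem card_subfaces_link_le (C : Finset (Finset V)) (v : V) (i : ℕ) :
    #{s ∈ subfaces (link C v) | #s = i} ≤ #{s ∈ subfaces C | v ∈ s ∧ #s = i + 1} := by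
  refine card_le_card_of_injOn (insert v) ?_ ?_
  · intro s hs
    obtain ⟨hs1, hs2⟩ := mem_filter.1 hs
    obtain ⟨G, hG, hsG⟩ := mem_subfaces.1 hs1
    obtain ⟨F, hF, hv, rfl⟩ := mem_link.1 hG
    have hvs : v ∉ s := fun h => (mem_erase.1 (hsG h)).1 rfl
    refine mem_filter.2 ⟨mem_subfaces.2 ⟨F, hF, insert_subset hv (hsG.trans (erase_subset _ _))⟩,
      mem_insert_self _ _, ?_⟩
    rw [card_insert_of_notMem hvs, hs2]
  · intro s hs t ht hst
    have key : ∀ s ∈ ({s ∈ subfaces (MultiparamComplex.link C v) | #s = i} : Finset _), v ∉ s := by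
      intro s hs h
      obtain ⟨G, hG, hsG⟩ := mem_subfaces.1 (mem_filter.1 hs).1
      obtain ⟨F, hF, hv, rfl⟩ := mem_link.1 hG
      exact (mem_erase.1 (hsG h)).1 rfl
    rw [← erase_insert (key s hs), hst, erase_insert (key t ht)]

/-- A ridge-cyclic family has at least as many faces of each size as the boundary of a simplex. -/
theorem choose_le_card_subfaces (d : ℕ) : ∀ (C : Finset (Finset V)), (∀ F ∈ C, #F = d) →
    RidgeCyclic C → C.Nonempty → ∀ i ≤ d, (d + 1).choose i ≤ #{s ∈ subfaces C | #s = i} := by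
  induction d with
  | zero =>
    intro C hd _ ⟨F, hF⟩ i hi
    obtain rfl : i = 0 := by omega
    have : (∅ : Finset V) ∈ ({s ∈ subfaces C | #s = 0} : Finset _) := by
      simp [mem_subfaces]; exact ⟨F, hF⟩
    simpa using card_pos.2 ⟨_, this⟩
  | succ d ih =>
    intro C hd hC ⟨F, hF⟩ i hi
    rcases i with _ | j
    · have : (∅ : Finset V) ∈ ({s ∈ subfaces C | #s = 0} : Finset _) := by
        simp [mem_subfaces]; exact ⟨F, hF⟩
      simpa using card_pos.2 ⟨_, this⟩
    obtain ⟨v, hv⟩ : F.Nonempty := card_pos.1 (by rw [hd F hF]; omega)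
    obtain ⟨F', hF', hne, hsub⟩ := hC F hF v hv
    have hvF' : v ∉ F' := fun h => hne (eq_of_subset_of_card_le
      (by rw [← insert_erase hv]; exact insert_subset h hsub) (by rw [hd F hF, hd F' hF'])).symm
    -- Pascal's rule: faces through `v` come from the link of `v`, again ridge-cyclic and of size
    -- one less, while `F'`, on the other side of the ridge opposite `v`, is a full simplex avoiding
    -- `v`.
    have h1 : (d + 1).choose j ≤ #{s ∈ subfaces C | v ∈ s ∧ #s = j + 1} := by
      refine (ih (MultiparamComplex.link C v) ?_ (hC.link v) ⟨_, mem_link.2 ⟨F, hF, hv, rfl⟩⟩ j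
        (by omega)).trans (card_subfaces_link_le C v j)
      intro G hG
      obtain ⟨E, hE, hvE, rfl⟩ := mem_link.1 hG
      rw [card_erase_of_mem hvE, hd E hE]; rfl
    have h2 : (d + 1).choose (j + 1) ≤ #{s ∈ subfaces C | v ∉ s ∧ #s = j + 1} := by
      rw [← hd F' hF', ← card_powersetCard]
      refine card_le_card fun s hs => ?_
      rw [mem_powersetCard] at hs
      exact mem_filter.2 ⟨mem_subfaces.2 ⟨F', hF', hs.1⟩, fun h => hvF' (hs.1 h), hs.2⟩
    have h3 : #{s ∈ subfaces C | v ∈ s ∧ #s = j + 1} + #{s ∈ subfaces C | v ∉ s ∧ #s = j + 1}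
        = #{s ∈ subfaces C | #s = j + 1} := by
      rw [← card_filter_add_card_filter_not (s := {s ∈ subfaces C | #s = j + 1}) (fun s => v ∈ s),
        filter_filter, filter_filter]
      simp only [and_comm]
    rw [Nat.choose_succ_succ', ← h3]; exact add_le_add h1 h2

/-! ### Costs of faces, and of growing a family vertex by vertex. -/

variable (b : ℕ → ℝ)

/-- The total cost of the faces of a simplex with `j` vertices. -/
def simplexCost (j : ℕ) : ℝ := ∑ i ∈ range (j + 1), j.choose i * b i

/-- The cost of joining a new vertex to a simplex with `j` vertices. -/
def joinCost (j : ℕ) : ℝ := ∑ i ∈ range (j + 1), j.choose i * b (i + 1)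

/-- The cost of joining a new vertex to the boundary of a simplex with `j` vertices. -/
def hollowJoinCost (j : ℕ) : ℝ := ∑ i ∈ range j, j.choose i * b (i + 1)

/-- The total cost of the faces generated by `C` which are not contained in `U`. -/
def outerCost (C : Finset (Finset V)) (U : Finset V) : ℝ :=
  ∑ s ∈ subfaces C with ¬ s ⊆ U, b #s

omit [DecidableEq V] in
theorem sum_powerset_cost (F : Finset V) : ∑ s ∈ F.powerset, b #s = simplexCost b #F := by
  rw [sum_powerset_apply_card, simplexCost]; simp

omit [DecidableEq V] in
theorem sum_powerset_joinCost (F : Finset V) :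
    ∑ s ∈ F.powerset, b (#s + 1) = joinCost b #F := by
  rw [sum_powerset_apply_card fun i => b (i + 1), joinCost]; simp

theorem simplexCost_succ (j : ℕ) : simplexCost b (j + 1) = simplexCost b j + joinCost b j := by
  have h : 0 ∉ (Finset.Icc 1 j) := by simp
  have hc : #(Finset.Icc 1 j) = j := by simp
  have h2 := sum_powerset_cost b (insert 0 (Finset.Icc 1 j))
  rw [card_insert_of_notMem h, hc, sum_powerset_insert h, sum_powerset_cost, hc] at h2
  rw [← h2, ← hc, ← sum_powerset_joinCost, hc]
  congr 1
  refine sum_congr rfl fun s hs => ?_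
  rw [card_insert_of_notMem fun h' => h (mem_powerset.1 hs h')]

theorem joinCost_eq (j : ℕ) : joinCost b j = hollowJoinCost b j + b (j + 1) := by
  rw [joinCost, sum_range_succ, hollowJoinCost]; simp

variable {b} (hb : ∀ i, 0 ≤ b i)

include hb

theorem joinCost_mono : Monotone (joinCost b) := by
  refine monotone_nat_of_le_succ fun j => ?_
  unfold joinCost
  rw [sum_range_succ _ (j + 1)]
  refine le_add_of_le_of_nonneg (sum_le_sum fun i _ => ?_) (mul_nonneg (by positivity) (hb _))
  exact mul_le_mul_of_nonneg_right (by exact_mod_cast Nat.choose_le_succ j i) (hb _)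

theorem joinCost_le_hollowJoinCost (j : ℕ) : joinCost b j ≤ hollowJoinCost b (j + 1) := by
  unfold joinCost hollowJoinCost
  refine sum_le_sum fun i _ => ?_
  exact mul_le_mul_of_nonneg_right (by exact_mod_cast Nat.choose_le_succ j i) (hb _)

/-- Faces through `v` correspond to faces of the link of `v`, which is ridge-cyclic with members of
size `m`, so `choose_le_card_subfaces` applies to it in each size. -/
theorem hollowJoinCost_le_star {m : ℕ} {C : Finset (Finset V)} (hd : ∀ F ∈ C, #F = m + 1)
    (hC : RidgeCyclic C) {v : V} (hv : v ∈ verts C) :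
    hollowJoinCost b (m + 1) ≤ ∑ s ∈ subfaces C with v ∈ s, b #s := by
  obtain ⟨F, hF, hvF⟩ := mem_verts.1 hv
  calc hollowJoinCost b (m + 1)
      ≤ ∑ i ∈ range (m + 1), ∑ s ∈ subfaces C with v ∈ s ∧ #s = i + 1, b #s := by
        refine sum_le_sum fun i hi => ?_
        have h1 : (m + 1).choose i ≤ #{s ∈ subfaces C | v ∈ s ∧ #s = i + 1} := by
          refine (choose_le_card_subfaces m (link C v) ?_ (hC.link v)
            ⟨_, mem_link.2 ⟨F, hF, hvF, rfl⟩⟩ i ?_).trans (card_subfaces_link_le C v i)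
          · intro G hG
            obtain ⟨E, hE, hvE, rfl⟩ := mem_link.1 hG
            rw [card_erase_of_mem hvE, hd E hE]; rfl
          · have := mem_range.1 hi; omega
        rw [sum_congr rfl (g := fun _ => b (i + 1)) fun s hs => by rw [(mem_filter.1 hs).2.2],
          sum_const, nsmul_eq_mul]
        exact mul_le_mul_of_nonneg_right (by exact_mod_cast h1) (hb _)
    _ ≤ ∑ s ∈ subfaces C with v ∈ s, b #s := by
        rw [← sum_biUnion]
        · refine sum_le_sum_of_subset_of_nonneg ?_ fun _ _ _ => hb _
          intro s hs
          simp only [mem_biUnion, mem_filter] at hs ⊢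
          obtain ⟨_, _, h1, h2, _⟩ := hs
          exact ⟨h1, h2⟩
        · intro i _ j _ hij
          refine disjoint_left.2 fun s hs ht => hij ?_
          have h1 := (mem_filter.1 hs).2.2
          have h2 := (mem_filter.1 ht).2.2
          omega

/-- Strong connectivity yields adjacent members, one inside `U` and one, `G`, not inside. They share
`m` vertices, so `G` has exactly one vertex `v` outside `U`, and adding `v` to `U` absorbs at least
the faces of `G` through `v`, whose cost is `joinCost b m`. -/
theorem exists_outerCost_insert_le {m : ℕ} {C : Finset (Finset V)} (hd : ∀ F ∈ C, #F = m + 1)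
    (hC : StronglyConnected m C) {F U : Finset V} (hF : F ∈ C) (hFU : F ⊆ U)
    (hne : (verts C \ U).Nonempty) :
    ∃ v ∈ verts C \ U, outerCost b C (insert v U) + joinCost b m ≤ outerCost b C U := by
  obtain ⟨F₁, hF₁, hF₁U, G, hG, hGU, hcard⟩ : ∃ F₁ ∈ C, F₁ ⊆ U ∧ ∃ G ∈ C, ¬ G ⊆ U ∧
      m ≤ #(F₁ ∩ G) := by
    by_contra! hcon
    have h := hC {E ∈ C | E ⊆ U} (filter_subset _ _) ⟨F, mem_filter.2 ⟨hF, hFU⟩⟩ ?_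
    · obtain ⟨x, hx⟩ := hne
      obtain ⟨hx1, hx2⟩ := mem_sdiff.1 hx
      obtain ⟨E, hE, hxE⟩ := mem_verts.1 hx1
      rw [← h] at hE
      exact hx2 ((mem_filter.1 hE).2 hxE)
    · intro E hE G hG hEG
      refine mem_filter.2 ⟨hG, ?_⟩
      by_contra hGU
      exact absurd hEG (not_le.2 (hcon E (mem_filter.1 hE).1 (mem_filter.1 hE).2 G hG hGU))
  obtain ⟨v, hvG, hvU⟩ := not_subset.1 hGU
  have hsub : F₁ ∩ G ⊆ G.erase v := fun x hx =>
    mem_erase.2 ⟨fun h => hvU (h ▸ hF₁U (mem_inter.1 hx).1), (mem_inter.1 hx).2⟩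
  have heq : F₁ ∩ G = G.erase v := eq_of_subset_of_card_le hsub (by
    rw [card_erase_of_mem hvG, hd G hG]; simpa using hcard)
  have hEU : G.erase v ⊆ U := heq ▸ inter_subset_left.trans hF₁U
  have hm : #(G.erase v) = m := by rw [card_erase_of_mem hvG, hd G hG]; rfl
  refine ⟨v, mem_sdiff.2 ⟨mem_verts.2 ⟨G, hG, hvG⟩, hvU⟩, ?_⟩
  rw [← hm, ← sum_powerset_joinCost]
  have himg : ∑ s ∈ (G.erase v).powerset, b (#s + 1)
      = ∑ s ∈ (G.erase v).powerset.image (insert v), b #s := by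
    rw [sum_image]
    · refine sum_congr rfl fun s hs => ?_
      rw [card_insert_of_notMem fun h => hvU (hEU (mem_powerset.1 hs h))]
    · intro s hs t ht hst
      have hs' : v ∉ s := fun h => hvU (hEU (mem_powerset.1 hs h))
      have ht' : v ∉ t := fun h => hvU (hEU (mem_powerset.1 ht h))
      rw [← erase_insert hs', hst, erase_insert ht']
  rw [himg, outerCost, outerCost, ← sum_union]
  · refine sum_le_sum_of_subset_of_nonneg ?_ fun _ _ _ => hb _
    intro s hs
    rcases mem_union.1 hs with hs | hs
    · exact mem_filter.2 ⟨(mem_filter.1 hs).1,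
        fun h => (mem_filter.1 hs).2 (h.trans (subset_insert _ _))⟩
    · obtain ⟨t, ht, rfl⟩ := mem_image.1 hs
      refine mem_filter.2 ⟨mem_subfaces.2 ⟨G, hG, insert_subset hvG
        ((mem_powerset.1 ht).trans (erase_subset _ _))⟩, fun h => hvU (h (mem_insert_self _ _))⟩
  · refine disjoint_left.2 fun s hs ht => (mem_filter.1 hs).2 ?_
    obtain ⟨u, hu, rfl⟩ := mem_image.1 ht
    exact insert_subset_insert _ ((mem_powerset.1 hu).trans hEU)

theorem outerCost_nonneg (C : Finset (Finset V)) (U : Finset V) : 0 ≤ outerCost b C U :=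
  sum_nonneg fun _ _ => hb _

theorem mul_joinCost_le_outerCost {m : ℕ} {C : Finset (Finset V)} (hd : ∀ F ∈ C, #F = m + 1)
    (hC : StronglyConnected m C) {F U : Finset V} (hF : F ∈ C) (hFU : F ⊆ U) :
    #(verts C \ U) * joinCost b m ≤ outerCost b C U := by
  induction hn : #(verts C \ U) generalizing U with
  | zero => simpa using outerCost_nonneg hb C U
  | succ n ih =>
    obtain ⟨v, hv, hle⟩ := exists_outerCost_insert_le hb hd hC hF hFU (card_pos.1 (by omega))
    have h := ih (hFU.trans (subset_insert v U)) (by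
      rw [sdiff_insert, card_erase_of_mem hv, hn]; rfl)
    push_cast; linarith

/-- The last vertex to be added has its whole star outside `U`, and in a ridge-cyclic family that
star costs at least `hollowJoinCost b (m + 1)`. This improvement over `mul_joinCost_le_outerCost` is
what makes the boundary of a simplex extremal. -/
theorem mul_joinCost_add_le_outerCost {m : ℕ} {C : Finset (Finset V)}
    (hd : ∀ F ∈ C, #F = m + 1) (hC : StronglyConnected m C) (hC' : RidgeCyclic C)
    {F U : Finset V} (hF : F ∈ C) (hFU : F ⊆ U) (hne : (verts C \ U).Nonempty) :
    (#(verts C \ U) - 1) * joinCost b m + hollowJoinCost b (m + 1) ≤ outerCost b C U := by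
  obtain ⟨n, hn⟩ : ∃ n, #(verts C \ U) = n + 1 := ⟨#(verts C \ U) - 1, by
    have := card_pos.2 hne; omega⟩
  induction n generalizing U with
  | zero =>
    obtain ⟨v, hv⟩ := hne
    have h := hollowJoinCost_le_star hb hd hC' (mem_sdiff.1 hv).1
    have h2 : ∑ s ∈ subfaces C with v ∈ s, b #s ≤ outerCost b C U := by
      refine sum_le_sum_of_subset_of_nonneg ?_ fun _ _ _ => hb _
      intro s hs
      rw [mem_filter] at hs ⊢
      exact ⟨hs.1, fun h => (mem_sdiff.1 hv).2 (h hs.2)⟩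
    rw [hn]; simp; linarith
  | succ n ih =>
    obtain ⟨v, hv, hle⟩ := exists_outerCost_insert_le hb hd hC hF hFU hne
    have hc : #(verts C \ insert v U) = n + 1 := by
      rw [sdiff_insert, card_erase_of_mem hv, hn]; rfl
    have h := ih (hFU.trans (subset_insert v U)) (card_pos.1 (by omega)) hc
    rw [hc] at h; rw [hn]
    push_cast at h ⊢; linarith

/-- The cost of completing a face which already meets the set `W`. -/
theorem outerCost_union_le {C : Finset (Finset V)} {F : Finset V} (hF : F ∈ C) (W : Finset V) :
    outerCost b C (W ∪ F) + (simplexCost b #F - simplexCost b #(F ∩ W)) ≤ outerCost b C W := by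
  rw [← sum_powerset_cost b F, ← sum_powerset_cost b (F ∩ W)]
  have h1 : ∑ s ∈ F.powerset, b #s - ∑ s ∈ (F ∩ W).powerset, b #s
      = ∑ s ∈ F.powerset \ (F ∩ W).powerset, b #s := by
    rw [← sum_sdiff (powerset_mono.2 (inter_subset_left (s₁ := F) (s₂ := W)))]; ring
  rw [h1, outerCost, outerCost, ← sum_union]
  · refine sum_le_sum_of_subset_of_nonneg ?_ fun _ _ _ => hb _
    intro s hs
    rcases mem_union.1 hs with hs | hs
    · exact mem_filter.2 ⟨(mem_filter.1 hs).1,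
        fun h => (mem_filter.1 hs).2 (h.trans subset_union_left)⟩
    · rw [Finset.mem_sdiff, mem_powerset, mem_powerset] at hs
      exact mem_filter.2 ⟨mem_subfaces.2 ⟨F, hF, hs.1⟩, fun h => hs.2 (subset_inter hs.1 h)⟩
  · refine disjoint_left.2 fun s hs ht => (mem_filter.1 hs).2 ?_
    rw [Finset.mem_sdiff, mem_powerset] at ht
    exact ht.1.trans subset_union_right

end Families

/-! ### Strong connectivity, components, and boundaries of simplices. -/

section Connectivity

open Finset

variable {V : Type*} [DecidableEq V]

theorem StronglyConnected.singleton (m : ℕ) (F : Finset V) : StronglyConnected m {F} :=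
  fun _ hD hne _ => hne.subset_singleton_iff.1 hD

theorem StronglyConnected.union {m : ℕ} {C D : Finset (Finset V)} (hC : StronglyConnected m C)
    (hD : StronglyConnected m D) {F : Finset V} (hFC : F ∈ C) (hFD : F ∈ D) :
    StronglyConnected m (C ∪ D) := by
  intro E hE hne hcl
  have h1 : (E ∩ C).Nonempty → C ⊆ E := fun h => by
    rw [← hC (E ∩ C) inter_subset_right h fun A hA B hB hAB => mem_inter.2
      ⟨hcl A (mem_inter.1 hA).1 B (mem_union_left _ hB) hAB, hB⟩]
    exact inter_subset_left
  have h2 : (E ∩ D).Nonempty → D ⊆ E := fun h => by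
    rw [← hD (E ∩ D) inter_subset_right h fun A hA B hB hAB => mem_inter.2
      ⟨hcl A (mem_inter.1 hA).1 B (mem_union_right _ hB) hAB, hB⟩]
    exact inter_subset_left
  obtain ⟨A, hA⟩ := hne
  refine hE.antisymm (union_subset ?_ ?_)
  · rcases mem_union.1 (hE hA) with h | h
    · exact h1 ⟨A, mem_inter.2 ⟨hA, h⟩⟩
    · exact h1 ⟨F, mem_inter.2 ⟨h2 ⟨A, mem_inter.2 ⟨hA, h⟩⟩ hFD, hFC⟩⟩
  · rcases mem_union.1 (hE hA) with h | h
    · exact h2 ⟨F, mem_inter.2 ⟨h1 ⟨A, mem_inter.2 ⟨hA, h⟩⟩ hFC, hFD⟩⟩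
    · exact h2 ⟨A, mem_inter.2 ⟨hA, h⟩⟩

theorem StronglyConnected.pair {m : ℕ} {F G : Finset V} (h : m ≤ #(F ∩ G)) :
    StronglyConnected m {F, G} := by
  intro E hE hne hcl
  have h' : m ≤ #(G ∩ F) := by rwa [inter_comm]
  obtain ⟨A, hA⟩ := hne
  refine hE.antisymm ?_
  rcases mem_insert.1 (hE hA) with rfl | hAG
  · exact insert_subset hA (singleton_subset_iff.2 (hcl _ hA G (by simp) h))
  · rw [mem_singleton] at hAG
    subst hAG
    exact insert_subset (hcl _ hA F (by simp) h') (singleton_subset_iff.2 hA)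

theorem RidgeCyclic.union {C D : Finset (Finset V)} (hC : RidgeCyclic C) (hD : RidgeCyclic D) :
    RidgeCyclic (C ∪ D) := by
  intro F hF y hy
  rcases mem_union.1 hF with hF | hF
  · obtain ⟨G, hG, h⟩ := hC F hF y hy
    exact ⟨G, mem_union_left _ hG, h⟩
  · obtain ⟨G, hG, h⟩ := hD F hF y hy
    exact ⟨G, mem_union_right _ hG, h⟩

/-- A nonempty subfamily closed under adjacency, of least cardinality, is automatically strongly
connected. -/
theorem exists_component (m : ℕ) {C : Finset (Finset V)} (hC : C.Nonempty) :
    ∃ D ⊆ C, D.Nonempty ∧ StronglyConnected m D ∧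
      ∀ F ∈ D, ∀ G ∈ C, m ≤ #(F ∩ G) → G ∈ D := by
  obtain ⟨D, hD, hmin⟩ := exists_min_image
    {D ∈ C.powerset | D.Nonempty ∧ ∀ F ∈ D, ∀ G ∈ C, m ≤ #(F ∩ G) → G ∈ D} card
    ⟨C, by simp [hC]; tauto⟩
  simp only [mem_filter, mem_powerset] at hD hmin
  refine ⟨D, hD.1, hD.2.1, fun E hE hne hcl => ?_, hD.2.2⟩
  exact eq_of_subset_of_card_le hE (hmin E ⟨hE.trans hD.1, hne, fun F hF G hG h =>
    hcl F hF G (hD.2.2 F (hE hF) G hG h) h⟩)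

theorem RidgeCyclic.of_closed {m : ℕ} {C D : Finset (Finset V)} (hd : ∀ F ∈ C, #F = m + 1)
    (hC : RidgeCyclic C) (hDC : D ⊆ C) (hcl : ∀ F ∈ D, ∀ G ∈ C, m ≤ #(F ∩ G) → G ∈ D) :
    RidgeCyclic D := by
  intro F hF y hy
  obtain ⟨G, hG, hne, hsub⟩ := hC F (hDC hF) y hy
  refine ⟨G, hcl F hF G hG ?_, hne, hsub⟩
  have := card_le_card (subset_inter (erase_subset y F) hsub)
  rw [card_erase_of_mem hy, hd F (hDC hF)] at this
  exact this

-- Adjoining an adjacent member adds at most one vertex, so no vertex number is skipped: a largest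
-- strongly connected subfamily with at most `M + 1` vertices has exactly that many. This turns the
-- exclusion of one size into the exclusion of all larger ones.
open Classical in
theorem exists_stronglyConnected_card_verts_eq {m M : ℕ} {C : Finset (Finset V)}
    (hd : ∀ F ∈ C, #F = m + 1) (hC : StronglyConnected m C) (hne : C.Nonempty) (hm : m ≤ M)
    (hM : M < #(verts C)) :
    ∃ D ⊆ C, D.Nonempty ∧ StronglyConnected m D ∧ #(verts D) = M + 1 := by
  obtain ⟨F₀, hF₀⟩ := hne
  obtain ⟨D, hD, hmax⟩ := exists_max_image
    {D ∈ C.powerset | D.Nonempty ∧ StronglyConnected m D ∧ #(verts D) ≤ M + 1} card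
    ⟨{F₀}, by
      simp only [mem_filter, mem_powerset, singleton_subset_iff]
      refine ⟨hF₀, singleton_nonempty _, .singleton _ _, ?_⟩
      simp [verts, hd F₀ hF₀, hm]⟩
  simp only [mem_filter, mem_powerset] at hD hmax
  refine ⟨D, hD.1, hD.2.1, hD.2.2.1, le_antisymm hD.2.2.2 ?_⟩
  by_contra! hlt
  have hDC : D ≠ C := fun h => by rw [h] at hlt; omega
  obtain ⟨F, hF, G, hG, hFG, hGD⟩ : ∃ F ∈ D, ∃ G ∈ C, m ≤ #(F ∩ G) ∧ G ∉ D := by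
    by_contra! hcon
    exact hDC (hC D hD.1 hD.2.1 hcon)
  have hsc : StronglyConnected m ({F, G} ∪ D) :=
    (StronglyConnected.pair hFG).union hD.2.2.1 (by simp) hF
  have heq : {F, G} ∪ D = insert G D := by
    ext; simp only [mem_union, mem_insert, mem_singleton]; grind
  rw [heq] at hsc
  have hcard : #(verts (insert G D)) ≤ M + 1 := by
    have h1 : verts (insert G D) ⊆ verts D ∪ (G \ (F ∩ G)) := by
      intro x hx
      obtain ⟨E, hE, hxE⟩ := mem_verts.1 hx
      rcases mem_insert.1 hE with rfl | hE
      · by_cases hxF : x ∈ F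
        · exact mem_union_left _ (subset_verts hF hxF)
        · exact mem_union_right _ (by simp [hxE, hxF])
      · exact mem_union_left _ (subset_verts hE hxE)
    have h2 := (card_le_card h1).trans (card_union_le _ _)
    rw [card_sdiff_of_subset inter_subset_right, hd G hG] at h2
    omega
  have := hmax (insert G D) ⟨insert_subset hG hD.1, insert_nonempty _ _, hsc, hcard⟩
  rw [card_insert_of_notMem hGD] at this
  omega

theorem card_verts_of_ridgeCyclic {m : ℕ} {C : Finset (Finset V)} (hd : ∀ F ∈ C, #F = m + 1)
    (hC : RidgeCyclic C) (hne : C.Nonempty) : m + 2 ≤ #(verts C) := by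
  obtain ⟨F, hF⟩ := hne
  obtain ⟨y, hy⟩ : F.Nonempty := card_pos.1 (by rw [hd F hF]; omega)
  obtain ⟨G, hG, hGF, _⟩ := hC F hF y hy
  have h : ¬ G ⊆ F := fun h => hGF (eq_of_subset_of_card_le h (by rw [hd F hF, hd G hG]))
  obtain ⟨u, huG, huF⟩ := not_subset.1 h
  have := card_le_card (insert_subset (subset_verts hG huG) (subset_verts hF))
  rw [card_insert_of_notMem huF, hd F hF] at this
  exact this

theorem exists_eq_erase {m : ℕ} {F S : Finset V} (hS : #S = m + 2) (hFS : F ⊆ S)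
    (hF : #F = m + 1) : ∃ x ∈ S, F = S.erase x := by
  obtain ⟨x, hxS, hxF⟩ : ∃ x ∈ S, x ∉ F := by
    by_contra! h
    have := card_le_card h
    omega
  refine ⟨x, hxS, eq_of_subset_of_card_le (fun z hz => mem_erase.2
    ⟨fun h => hxF (h ▸ hz), hFS hz⟩) ?_⟩
  rw [card_erase_of_mem hxS, hS, hF]; rfl

theorem erase_mem_powersetCard {m : ℕ} {S : Finset V} (hS : #S = m + 2) {x : V} (hx : x ∈ S) :
    S.erase x ∈ powersetCard (m + 1) S :=
  mem_powersetCard.2 ⟨erase_subset _ _, by rw [card_erase_of_mem hx, hS]; rfl⟩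

/-- Inside `S` the ridge `S \ {x, y}` lies only in `S \ {x}` and `S \ {y}`, so ridge-cyclicity
forces every facet of `S` as soon as one is present. -/
theorem RidgeCyclic.eq_powersetCard {m : ℕ} {C : Finset (Finset V)} (hd : ∀ F ∈ C, #F = m + 1)
    (hC : RidgeCyclic C) (hne : C.Nonempty) {S : Finset V} (hS : #S = m + 2)
    (hCS : ∀ F ∈ C, F ⊆ S) : C = powersetCard (m + 1) S := by
  refine Subset.antisymm (fun F hF => mem_powersetCard.2 ⟨hCS F hF, hd F hF⟩) fun G hG => ?_
  rw [mem_powersetCard] at hG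
  obtain ⟨y, hyS, rfl⟩ := exists_eq_erase hS hG.1 hG.2
  obtain ⟨F, hF⟩ := hne
  obtain ⟨x, hxS, rfl⟩ := exists_eq_erase hS (hCS F hF) (hd F hF)
  by_cases hxy : y = x
  · rwa [hxy]
  obtain ⟨G, hG, hne, hsub⟩ := hC _ hF y (mem_erase.2 ⟨hxy, hyS⟩)
  obtain ⟨z, hzS, rfl⟩ := exists_eq_erase hS (hCS G hG) (hd G hG)
  have hzx : z ≠ x := fun h => hne (by rw [h])
  have hzy : z = y := by
    by_contra h
    exact notMem_erase z S (hsub (mem_erase.2 ⟨h, mem_erase.2 ⟨hzx, hzS⟩⟩))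
  rwa [← hzy]

theorem verts_powersetCard {m : ℕ} {S : Finset V} (hS : #S = m + 2) :
    verts (powersetCard (m + 1) S) = S := by
  ext x
  rw [mem_verts]
  refine ⟨fun ⟨F, hF, hx⟩ => (mem_powersetCard.1 hF).1 hx, fun hx => ?_⟩
  obtain ⟨y, hy⟩ : (S.erase x).Nonempty := card_pos.1 (by rw [card_erase_of_mem hx, hS]; omega)
  exact ⟨S.erase y, erase_mem_powersetCard hS (mem_erase.1 hy).2,
    mem_erase.2 ⟨(mem_erase.1 hy).1.symm, hx⟩⟩

theorem ridgeCyclic_powersetCard {m : ℕ} {S : Finset V} (hS : #S = m + 2) :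
    RidgeCyclic (powersetCard (m + 1) S) := by
  intro F hF y hy
  obtain ⟨x, hxS, rfl⟩ := exists_eq_erase hS (mem_powersetCard.1 hF).1 (mem_powersetCard.1 hF).2
  refine ⟨S.erase y, erase_mem_powersetCard hS (mem_erase.1 hy).2, fun h => ?_, ?_⟩
  · exact notMem_erase y S (h ▸ hy)
  · exact erase_subset_erase _ (erase_subset _ _)

theorem stronglyConnected_powersetCard {m : ℕ} {S : Finset V} (hS : #S = m + 2) :
    StronglyConnected m (powersetCard (m + 1) S) := by
  intro D hD hne hcl
  refine hD.antisymm fun G hG => ?_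
  obtain ⟨F, hF⟩ := hne
  refine hcl F hF G hG ?_
  have hF' := mem_powersetCard.1 (hD hF)
  have hG' := mem_powersetCard.1 hG
  have h1 := card_le_card (union_subset hF'.1 hG'.1)
  have h2 := card_union_add_card_inter F G
  omega

end Connectivity

/-! ### Bounds on the exponents of families relative to a set of used vertices. -/

section Exponents

open Finset

/-- The face costs `b` (indexed by the number of vertices) for which `k` is the critical
dimension, together with the dimension `m > k` and the exponent `e` of the number of boundaries
of `(m + 1)`-simplices. -/
structure CostData (b : ℕ → ℝ) (k m : ℕ) (e : ℝ) : Prop where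
  nonneg : ∀ i, 0 ≤ b i
  zero : b 0 = 0
  one : b 1 = 0
  lt : k < m
  join_lt : joinCost b k < 1
  lt_join : 1 < joinCost b (k + 1)
  exponent : e = (m + 2 : ℝ) - simplexCost b (m + 2) + b (m + 2)
  pos : 0 < e

namespace CostData

variable {b : ℕ → ℝ} {k m : ℕ} {e : ℝ}

theorem one_lt_joinCost (h : CostData b k m e) : 1 < joinCost b m :=
  h.lt_join.trans_le (joinCost_mono h.nonneg h.lt)

theorem one_lt_hollowJoinCost (h : CostData b k m e) : 1 < hollowJoinCost b (m + 1) :=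
  h.one_lt_joinCost.trans_le (joinCost_le_hollowJoinCost h.nonneg m)

/-- The boundary of a simplex is built as one full facet followed by the cone from the last vertex
over the boundary of that facet. -/
theorem exponent_eq (h : CostData b k m e) :
    e = (m + 1 : ℝ) - simplexCost b (m + 1) + (1 - hollowJoinCost b (m + 1)) := by
  have h1 : simplexCost b (m + 2) = _ := simplexCost_succ b (m + 1)
  rw [h.exponent, h1, joinCost_eq]; ring

/-- The function `j ↦ j - simplexCost b j` has increments `1 - joinCost b j`, positive for `j ≤ k`
and negative from `k + 1` on. It thus stays at least `1`, its value at `j = 1`, up to `k + 1`;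
`anti_of_le` records the decrease afterwards. -/
theorem one_le_of_le (h : CostData b k m e) (w : ℕ) (hw : w ≤ k) :
    (1 : ℝ) ≤ (w + 1 : ℕ) - simplexCost b (w + 1) := by
  induction w with
  | zero => simp [simplexCost, sum_range_succ, h.zero, h.one]
  | succ w ih =>
    have h1 : simplexCost b (w + 1 + 1) = _ := simplexCost_succ b (w + 1)
    have h2 : joinCost b (w + 1) ≤ joinCost b k := joinCost_mono h.nonneg hw
    have := ih (by omega)
    have := h.join_lt
    rw [h1]; push_cast at *; linarith

theorem anti_of_le (h : CostData b k m e) {w n : ℕ} (hkw : k + 1 ≤ w) (hwn : w ≤ n) :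
    (n : ℝ) - simplexCost b n ≤ w - simplexCost b w := by
  induction n, hwn using Nat.le_induction with
  | base => exact le_rfl
  | succ n hn ih =>
    have h1 := simplexCost_succ b n
    have h2 : joinCost b (k + 1) ≤ joinCost b n := joinCost_mono h.nonneg (by omega)
    have := h.lt_join
    rw [h1]; push_cast at *; linarith

variable {V : Type*} [DecidableEq V]

/-- Start from a member `F` with the largest intersection with `W`, complete `F`, then add the other
vertices one by one. The alternatives correspond to `#(F ∩ W)` being above `k`, between `1` and `k`,
or zero. -/
theorem exponent_cases (h : CostData b k m e) {C : Finset (Finset V)}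
    (hd : ∀ F ∈ C, #F = m + 1) (hne : C.Nonempty) (hC : StronglyConnected m C)
    (hC' : RidgeCyclic C) (W : Finset V) :
    (#(verts C \ W) : ℝ) - outerCost b C W ≤ 0 ∨
    ((verts C ∩ W).Nonempty ∧ (#(verts C \ W) : ℝ) - outerCost b C W ≤ e - 1) ∨
    (verts C ∩ W = ∅ ∧
      (#(verts C \ W) : ℝ) - outerCost b C W ≤ e + (#(verts C) - (m + 2)) * (1 - joinCost b m)) := by
  have hcard : ∀ F ∈ C, #(verts C \ W) + #(F ∩ W) = #(verts C \ (W ∪ F)) + (m + 1) := by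
    intro F hF
    have h1 : (verts C \ W) = (verts C \ (W ∪ F)) ∪ (F \ W) := by
      ext x
      have := @subset_verts _ _ C F hF x
      simp only [Finset.mem_sdiff, mem_union]; tauto
    rw [h1, card_union_of_disjoint, add_assoc, add_comm #(F \ W), card_inter_add_card_sdiff, hd F hF]
    exact disjoint_left.2 fun x hx hx' => (Finset.mem_sdiff.1 hx).2
      (mem_union_right _ (Finset.mem_sdiff.1 hx').1)
  have hcardR : ∀ F ∈ C, (#(verts C \ W) : ℝ) = #(verts C \ (W ∪ F)) + (m + 1) - #(F ∩ W) := by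
    intro F hF
    rw [eq_sub_iff_add_eq]; exact_mod_cast hcard F hF
  have hj := h.one_lt_joinCost
  have hj' := h.one_lt_hollowJoinCost
  obtain ⟨F, hF, hmax⟩ := exists_max_image C (fun F => #(F ∩ W)) hne
  have hcF := hcardR F hF
  have hun := outerCost_union_le h.nonneg hF W
  rw [hd F hF] at hun
  by_cases hw : k + 1 ≤ #(F ∩ W)
  · left
    have h1 := mul_joinCost_le_outerCost h.nonneg hd hC hF (subset_union_right (s₁ := W))
    have h2 := h.anti_of_le hw ((card_le_card inter_subset_left).trans (hd F hF).le)
    have h3 : (0 : ℝ) ≤ #(verts C \ (W ∪ F)) * (joinCost b m - 1) :=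
      mul_nonneg (Nat.cast_nonneg _) (by linarith)
    push_cast at h2
    linarith
  right
  -- If the new vertex `u` of the neighbour `G` across a ridge opposite some `y ∉ W` were in `W`,
  -- then `G` would meet `W` in more vertices than `F` does. So a vertex outside `W ∪ F` remains,
  -- and the stronger bound for the last vertex is available.
  have hne' : (verts C \ (W ∪ F)).Nonempty := by
    obtain ⟨y, hyF, hyW⟩ : ∃ y ∈ F, y ∉ W := by
      by_contra! hsub
      rw [inter_eq_left.2 hsub, hd F hF] at hw
      have := h.lt
      omega
    obtain ⟨G, hG, hGF, hsub⟩ := hC' F hF y hyF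
    have hnsub : ¬ G ⊆ F := fun h => hGF (eq_of_subset_of_card_le h (by rw [hd F hF, hd G hG]))
    obtain ⟨u, huG, huF⟩ := not_subset.1 hnsub
    refine ⟨u, Finset.mem_sdiff.2 ⟨subset_verts hG huG, fun hu => ?_⟩⟩
    rcases mem_union.1 hu with hu | hu
    · have h1 : insert u (F ∩ W) ⊆ G ∩ W := by
        refine insert_subset (mem_inter.2 ⟨huG, hu⟩) fun x hx => ?_
        rw [mem_inter] at hx ⊢
        exact ⟨hsub (mem_erase.2 ⟨fun h => hyW (h ▸ hx.2), hx.1⟩), hx.2⟩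
      have h2 := card_le_card h1
      rw [card_insert_of_notMem fun h => huF (mem_inter.1 h).1] at h2
      have := hmax G hG
      omega
    · exact huF hu
  have h1 := mul_joinCost_add_le_outerCost h.nonneg hd hC hC' hF
    (subset_union_right (s₁ := W)) hne'
  have hpos : (1 : ℝ) ≤ #(verts C \ (W ∪ F)) := by exact_mod_cast card_pos.2 hne'
  have he := h.exponent_eq
  rcases Nat.eq_zero_or_pos #(F ∩ W) with hz | hz
  · right
    have hdisj' : Disjoint (verts C) W := by
      refine disjoint_left.2 fun x hx hxW => ?_
      obtain ⟨E, hE, hxE⟩ := mem_verts.1 hx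
      have := hmax E hE
      have := card_pos.2 ⟨x, mem_inter.2 ⟨hxE, hxW⟩⟩
      omega
    have hdisj : verts C \ W = verts C := sdiff_eq_self_of_disjoint hdisj'
    refine ⟨disjoint_iff_inter_eq_empty.1 hdisj', ?_⟩
    have hc := hcard F hF
    rw [hdisj, hz] at hc
    have hc' : (#(verts C) : ℝ) = #(verts C \ (W ∪ F)) + (m + 1) := by exact_mod_cast hc
    rw [hz] at hun
    have h0 : simplexCost b 0 = 0 := by simp [simplexCost, h.zero]
    rw [h0] at hun
    rw [hdisj, hc', he]
    linarith
  · left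
    obtain ⟨x, hx⟩ := card_pos.1 hz
    rw [mem_inter] at hx
    refine ⟨⟨x, mem_inter.2 ⟨subset_verts hF hx.1, hx.2⟩⟩, ?_⟩
    have h2 := h.one_le_of_le (#(F ∩ W) - 1) (by omega)
    rw [Nat.sub_add_cancel hz] at h2
    have h3 : (0 : ℝ) ≤ (#(verts C \ (W ∪ F)) - 1) * (joinCost b m - 1) :=
      mul_nonneg (by linarith) (by linarith)
    rw [hcF, he]
    linarith

/-- The gain in the exponent for configurations other than a fresh boundary of a simplex. -/
noncomputable def gap (b : ℕ → ℝ) (m : ℕ) (e : ℝ) : ℝ := min (min 1 e) (joinCost b m - 1)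

theorem gap_pos (h : CostData b k m e) : 0 < gap b m e :=
  lt_min (lt_min one_pos h.pos) (by linarith [h.one_lt_joinCost])

theorem gap_le_exponent : gap b m e ≤ e := (min_le_left _ _).trans (min_le_right _ _)

theorem exponent_le (h : CostData b k m e) {C : Finset (Finset V)}
    (hd : ∀ F ∈ C, #F = m + 1) (hne : C.Nonempty) (hC : StronglyConnected m C)
    (hC' : RidgeCyclic C) (W : Finset V) :
    (#(verts C \ W) : ℝ) - outerCost b C W ≤ e := by
  have h1 : (m + 2 : ℝ) ≤ #(verts C) := by exact_mod_cast card_verts_of_ridgeCyclic hd hC' hne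
  have hj := h.one_lt_joinCost
  have := h.pos
  rcases h.exponent_cases hd hne hC hC' W with h2 | ⟨_, h2⟩ | ⟨_, h2⟩
  · linarith
  · linarith
  · nlinarith

/-- The three terms in `gap` pay for the three alternatives of `exponent_cases`: a nonpositive
exponent loses `e`, a partial overlap loses `1`, and a disjoint family with a surplus vertex loses
`joinCost b m - 1`. -/
theorem exponent_le_sub_gap (h : CostData b k m e) {C : Finset (Finset V)}
    (hd : ∀ F ∈ C, #F = m + 1) (hne : C.Nonempty) (hC : StronglyConnected m C)
    (hC' : RidgeCyclic C) (hbad : m + 3 ≤ #(verts C)) (W : Finset V) :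
    (#(verts C \ W) : ℝ) - outerCost b C W ≤ e - gap b m e := by
  have h1 : (m + 3 : ℝ) ≤ #(verts C) := by exact_mod_cast hbad
  have hj := h.one_lt_joinCost
  have h3 : gap b m e ≤ e := gap_le_exponent
  have h4 : gap b m e ≤ 1 := (min_le_left _ _).trans (min_le_left _ _)
  have h5 : gap b m e ≤ joinCost b m - 1 := min_le_right _ _
  rcases h.exponent_cases hd hne hC hC' W with h2 | ⟨_, h2⟩ | ⟨_, h2⟩
  · linarith
  · linarith
  · nlinarith

/-- Without a surplus vertex the third alternative of `exponent_cases` has no loss, but it is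
excluded here because `S` meets `W`. -/
theorem exponent_hollow_le_sub_gap (h : CostData b k m e) {S W : Finset V} (hS : #S = m + 2)
    (hSW : (S ∩ W).Nonempty) :
    (#(S \ W) : ℝ) - outerCost b (powersetCard (m + 1) S) W ≤ e - gap b m e := by
  have h3 : gap b m e ≤ e := gap_le_exponent
  have h4 : gap b m e ≤ 1 := (min_le_left _ _).trans (min_le_left _ _)
  have h1 := h.exponent_cases (C := powersetCard (m + 1) S)
    (fun F hF => (mem_powersetCard.1 hF).2) (powersetCard_nonempty.2 (by omega))
    (stronglyConnected_powersetCard hS) (ridgeCyclic_powersetCard hS) W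
  rw [verts_powersetCard hS] at h1
  rcases h1 with h2 | ⟨_, h2⟩ | ⟨h0, _⟩
  · linarith
  · linarith
  · exact absurd h0 hSW.ne_empty

/-- Large strongly connected families are very expensive. -/
theorem exponent_stronglyConnected_le (h : CostData b k m e) {C : Finset (Finset V)}
    (hd : ∀ F ∈ C, #F = m + 1) (hne : C.Nonempty) (hC : StronglyConnected m C) :
    (#(verts C) : ℝ) - outerCost b C ∅ ≤
      (m + 1) + (#(verts C) - (m + 1)) * (1 - joinCost b m) := by
  obtain ⟨F, hF⟩ := hne
  have hun := outerCost_union_le h.nonneg hF ∅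
  have h1 := mul_joinCost_le_outerCost h.nonneg hd hC hF (subset_union_right (s₁ := ∅))
  have h0 : simplexCost b 0 = 0 := by simp [simplexCost, h.zero]
  have hs : 0 ≤ simplexCost b (m + 1) :=
    sum_nonneg fun i _ => mul_nonneg (Nat.cast_nonneg _) (h.nonneg _)
  rw [hd F hF, inter_empty, card_empty, h0] at hun
  rw [empty_union, card_sdiff_of_subset (subset_verts hF), hd F hF,
    Nat.cast_sub (by rw [← hd F hF]; exact card_le_card (subset_verts hF))] at h1
  rw [empty_union] at hun
  push_cast at h1
  linarith

/-- Filling a boundary of a simplex costs `b (m + 2)` more. -/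
theorem exponent_simplex_le (h : CostData b k m e) {S : Finset V} (hS : #S = m + 2)
    (W : Finset V) :
    (#(S \ W) : ℝ) - outerCost b {S} W ≤ e - min e (b (m + 2)) := by
  by_cases hSW : S ⊆ W
  · rw [sdiff_eq_empty_iff_subset.2 hSW]
    have := outerCost_nonneg h.nonneg {S} W
    have := min_le_left e (b (m + 2))
    rw [card_empty, Nat.cast_zero]; linarith
  have h1 := h.exponent_le (C := powersetCard (m + 1) S) (fun F hF => (mem_powersetCard.1 hF).2)
    (powersetCard_nonempty.2 (by omega)) (stronglyConnected_powersetCard hS)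
    (ridgeCyclic_powersetCard hS) W
  rw [verts_powersetCard hS] at h1
  -- The only face gained by filling is `S` itself, and it counts as outer since `S` is not inside
  -- `W`.
  have h2 : outerCost b (powersetCard (m + 1) S) W + b (m + 2) ≤ outerCost b {S} W := by
    rw [← hS, ← sum_singleton (fun s => b #s) S, outerCost, outerCost, ← sum_union]
    · refine sum_le_sum_of_subset_of_nonneg ?_ fun _ _ _ => h.nonneg _
      intro s hs
      rcases mem_union.1 hs with hs | hs
      · rw [mem_filter, mem_subfaces] at hs
        obtain ⟨⟨F, hF, hsF⟩, hsW⟩ := hs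
        exact mem_filter.2 ⟨mem_subfaces.2 ⟨S, by simp,
          hsF.trans (mem_powersetCard.1 hF).1⟩, hsW⟩
      · rw [mem_singleton] at hs
        subst hs
        exact mem_filter.2 ⟨mem_subfaces.2 ⟨s, by simp, subset_rfl⟩, hSW⟩
    · refine disjoint_singleton_right.2 fun hs => ?_
      obtain ⟨F, hF, hsF⟩ := mem_subfaces.1 (mem_filter.1 hs).1
      have := card_le_card hsF
      rw [(mem_powersetCard.1 hF).2] at this
      omega
  have := min_le_right e (b (m + 2))
  linarith

end CostData

end Exponents

/-! ### Moments of the number of present families. -/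

section Moments

open Finset

variable {n : ℕ}

/-- The law of the coins. -/
noncomputable def coinLaw (n : ℕ) (p : ℕ → unitInterval) : Measure (Finset (Fin n) → Bool) :=
  Measure.pi fun s : Finset (Fin n) => bernoulliMeasure true false (p (s.card - 1))

instance (n : ℕ) (p : ℕ → unitInterval) : IsProbabilityMeasure (coinLaw n p) := by
  unfold coinLaw; infer_instance

/-- All faces generated by `C` are present. -/
def Present (C : Finset (Finset (Fin n))) (c : Finset (Fin n) → Bool) : Prop :=
  ∀ s ∈ subfaces C, 2 ≤ #s → c s = true

instance (C : Finset (Finset (Fin n))) (c : Finset (Fin n) → Bool) : Decidable (Present C c) := by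
  unfold Present; infer_instance

/-- The indicator of the presence of all faces generated by `C`. -/
def ind (C : Finset (Finset (Fin n))) (c : Finset (Fin n) → Bool) : ℝ :=
  if Present C c then 1 else 0

theorem ind_nonneg (C : Finset (Finset (Fin n))) (c : Finset (Fin n) → Bool) : 0 ≤ ind C c := by
  unfold ind; split_ifs <;> simp

theorem ind_empty (c : Finset (Fin n) → Bool) : ind ∅ c = 1 := by
  simp [ind, Present, subfaces]

theorem present_union (C D : Finset (Finset (Fin n))) (c : Finset (Fin n) → Bool) :
    Present (C ∪ D) c ↔ Present C c ∧ Present D c := by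
  simp only [Present, subfaces_union, mem_union]; grind

theorem ind_union (C D : Finset (Finset (Fin n))) (c : Finset (Fin n) → Bool) :
    ind (C ∪ D) c = ind C c * ind D c := by
  simp only [ind, present_union]; split_ifs <;> simp_all

theorem ind_biUnion {ι : Type*} [DecidableEq ι] (s : Finset ι) (g : ι → Finset (Finset (Fin n)))
    (c : Finset (Fin n) → Bool) : ind (s.biUnion g) c = ∏ i ∈ s, ind (g i) c := by
  induction s using Finset.induction_on with
  | empty => simp [ind_empty]
  | insert i s hi ih => rw [biUnion_insert, ind_union, ih, prod_insert hi]

variable (p : ℕ → unitInterval)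

/-- The probability that the coin of a set with `j` elements does not prevent it from being a
face. -/
noncomputable def faceProb (j : ℕ) : ℝ := if 2 ≤ j then (p (j - 1) : ℝ) else 1

/-- The probability that all faces generated by `C` are present. -/
noncomputable def weight (C : Finset (Finset (Fin n))) : ℝ := ∏ s ∈ subfaces C, faceProb p #s

theorem faceProb_nonneg (j : ℕ) : 0 ≤ faceProb p j := by
  unfold faceProb; split_ifs
  · exact (p _).2.1
  · exact zero_le_one

theorem faceProb_le_one (j : ℕ) : faceProb p j ≤ 1 := by
  unfold faceProb; split_ifs
  · exact (p _).2.2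
  · exact le_rfl

theorem weight_nonneg (C : Finset (Finset (Fin n))) : 0 ≤ weight p C :=
  prod_nonneg fun _ _ => faceProb_nonneg p _

theorem weight_empty : weight p (∅ : Finset (Finset (Fin n))) = 1 := by
  simp [weight, subfaces]

theorem integrable_coinLaw (f : (Finset (Fin n) → Bool) → ℝ) : Integrable f (coinLaw n p) :=
  Integrable.of_finite

/-- The indicator is a product over all sets of functions of single coins, which are independent. -/
theorem integral_ind (C : Finset (Finset (Fin n))) : ∫ c, ind C c ∂coinLaw n p = weight p C := by
  let g : Finset (Fin n) → Bool → ℝ := fun s x =>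
    if s ∈ subfaces C ∧ 2 ≤ #s then (if x = true then 1 else 0) else 1
  have h : ∀ c : Finset (Fin n) → Bool, ind C c = ∏ s, g s (c s) := by
    intro c
    unfold ind
    split_ifs with hc
    · symm
      refine prod_eq_one fun s _ => ?_
      simp only [g]
      split_ifs with h1 h2
      · rfl
      · exact absurd (hc s h1.1 h1.2) h2
      · rfl
    · unfold Present at hc
      push Not at hc
      obtain ⟨s, hs, h2, hcs⟩ := hc
      symm
      refine prod_eq_zero (mem_univ s) ?_
      simp [g, hs, h2, hcs]
  rw [integral_congr_ae (Eventually.of_forall h), coinLaw, integral_fintype_prod_eq_prod g, weight, ← prod_subset (subset_univ (subfaces C))]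
  · refine prod_congr rfl fun s hs => ?_
    rw [integral_bernoulliMeasure, faceProb]
    by_cases h2 : 2 ≤ #s <;> simp [g, hs, h2]
  · intro s _ hs
    rw [integral_bernoulliMeasure]
    simp [g, hs]

theorem weight_union (C D : Finset (Finset (Fin n))) :
    weight p (C ∪ D) = weight p C * ∏ s ∈ subfaces D \ subfaces C, faceProb p #s := by
  rw [weight, subfaces_union, ← union_sdiff_self_eq_union, prod_union disjoint_sdiff, weight]

/-- Positive correlation: common faces are paid for once in the union but twice in the product. -/
theorem weight_mul_le (C D : Finset (Finset (Fin n))) :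
    weight p C * weight p D ≤ weight p (C ∪ D) := by
  rw [weight_union]
  refine mul_le_mul_of_nonneg_left ?_ (weight_nonneg p C)
  rw [weight, ← prod_sdiff (sdiff_subset (s := subfaces D) (t := subfaces C))]
  exact mul_le_of_le_one_left (prod_nonneg fun _ _ => faceProb_nonneg p _)
    (prod_le_one (fun _ _ => faceProb_nonneg p _) fun _ _ => faceProb_le_one p _)

theorem prod_weight_le {ι : Type*} [DecidableEq ι] (s : Finset ι)
    (g : ι → Finset (Finset (Fin n))) : ∏ i ∈ s, weight p (g i) ≤ weight p (s.biUnion g) := by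
  induction s using Finset.induction_on with
  | empty => simp [weight_empty]
  | insert i s hi ih =>
    rw [biUnion_insert, prod_insert hi]
    exact (mul_le_mul_of_nonneg_left ih (weight_nonneg p _)).trans (weight_mul_le p _ _)

theorem weight_union_of_disjoint {C D : Finset (Finset (Fin n))}
    (h : Disjoint (verts C) (verts D)) : weight p (C ∪ D) = weight p C * weight p D := by
  rw [weight, subfaces_union, weight, weight, ← prod_union_inter]
  symm
  refine mul_right_eq_self₀.2 (Or.inl (prod_eq_one fun s hs => ?_))
  have : s = ∅ := by
    rw [← Finset.subset_empty, ← disjoint_iff_inter_eq_empty.1 h]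
    exact subset_inter (subset_verts_of_mem_subfaces (mem_inter.1 hs).1)
      (subset_verts_of_mem_subfaces (mem_inter.1 hs).2)
  simp [this, faceProb]

/-- The sum factors over vertices into `2 ^ #U` times a power of `1 + 1/n` with exponent at most
`n`; the proof bounds the latter by `(1 + 1/n) ^ n ≤ exp 1 < 3`. -/
theorem sum_inv_pow_card_sdiff_le (U : Finset (Fin n)) :
    ∑ T : Finset (Fin n), ((n : ℝ)⁻¹) ^ #(T \ U) ≤ 2 ^ #U * 3 := by
  have h : ∀ T : Finset (Fin n), ((n : ℝ)⁻¹) ^ #(T \ U) =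
      ∏ v ∈ T, if v ∈ U then 1 else (n : ℝ)⁻¹ := by
    intro T
    rw [prod_ite, prod_const_one, one_mul, prod_const, filter_notMem_eq_sdiff]
  simp_rw [h]
  rw [← powerset_univ, ← prod_one_add]
  have h2 : ∏ v : Fin n, (1 + if v ∈ U then (1 : ℝ) else (n : ℝ)⁻¹)
      ≤ (∏ v : Fin n, if v ∈ U then (2 : ℝ) else 1) * ∏ v : Fin n, (1 + (n : ℝ)⁻¹) := by
    rw [← prod_mul_distrib]
    refine prod_le_prod (fun v _ => by split_ifs <;> positivity) fun v _ => ?_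
    have : (0 : ℝ) ≤ (n : ℝ)⁻¹ := by positivity
    split_ifs <;> linarith
  refine h2.trans ?_
  rw [prod_ite, prod_const_one, mul_one, prod_const, prod_const, filter_mem_eq_inter, univ_inter,
    card_univ, Fintype.card_fin]
  refine mul_le_mul_of_nonneg_left ?_ (by positivity)
  rcases Nat.eq_zero_or_pos n with rfl | hn
  · simp
  calc (1 + (n : ℝ)⁻¹) ^ n ≤ (Real.exp (n : ℝ)⁻¹) ^ n := by
        refine pow_le_pow_left₀ (by positivity) ?_ n
        rw [add_comm]; exact Real.add_one_le_exp _
    _ = Real.exp 1 := by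
        rw [← Real.exp_nat_mul, mul_inv_cancel₀ (by positivity)]
    _ ≤ 3 := Real.exp_one_lt_three.le

variable {p} {b : ℕ → ℝ} {J : ℕ}

theorem weight_eq_rpow (hp : ∀ j ≤ J, faceProb p j = (n : ℝ) ^ (-b j)) (hn : 0 < n)
    {C : Finset (Finset (Fin n))} (hC : ∀ F ∈ C, #F ≤ J) :
    weight p C = (n : ℝ) ^ (-∑ s ∈ subfaces C, b #s) := by
  rw [← sum_neg_distrib, Real.rpow_sum_of_pos (by exact_mod_cast hn), weight]
  refine prod_congr rfl fun s hs => ?_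
  obtain ⟨F, hF, hsF⟩ := mem_subfaces.1 hs
  exact hp _ ((card_le_card hsF).trans (hC F hF))

theorem weight_union_le (hp : ∀ j ≤ J, faceProb p j = (n : ℝ) ^ (-b j)) (hn : 0 < n)
    (Y : Finset (Finset (Fin n))) {C : Finset (Finset (Fin n))} (hC : ∀ F ∈ C, #F ≤ J) :
    weight p (Y ∪ C) ≤ weight p Y * (n : ℝ) ^ (-outerCost b C (verts Y)) := by
  rw [weight_union]
  refine mul_le_mul_of_nonneg_left ?_ (weight_nonneg p Y)
  rw [outerCost, ← sum_neg_distrib, Real.rpow_sum_of_pos (by exact_mod_cast hn)]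
  have hsub : {s ∈ subfaces C | ¬ s ⊆ verts Y} ⊆ subfaces C \ subfaces Y := by
    intro s hs
    rw [mem_filter] at hs
    exact Finset.mem_sdiff.2 ⟨hs.1, fun h => hs.2 (subset_verts_of_mem_subfaces h)⟩
  rw [← prod_sdiff hsub]
  refine (mul_le_of_le_one_left (prod_nonneg fun _ _ => faceProb_nonneg p _)
    (prod_le_one (fun _ _ => faceProb_nonneg p _) fun _ _ => faceProb_le_one p _)).trans_eq ?_
  refine prod_congr rfl fun s hs => ?_
  obtain ⟨F, hF, hsF⟩ := mem_subfaces.1 (mem_filter.1 hs).1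
  exact hp _ ((card_le_card hsF).trans (hC F hF))

/-- Each new vertex offers about `n` choices, compensated by the factor `n⁻¹` per new vertex.
Families are grouped by vertex set; a set of at most `M` vertices carries at most `2 ^ 2 ^ M`
families. -/
theorem sum_weight_union_le (hp : ∀ j ≤ J, faceProb p j = (n : ℝ) ^ (-b j)) (hn : 0 < n)
    {M : ℕ} {e : ℝ} (Fam : Finset (Finset (Finset (Fin n)))) (hJ : ∀ C ∈ Fam, ∀ F ∈ C, #F ≤ J)
    (hM : ∀ C ∈ Fam, #(verts C) ≤ M) (Y : Finset (Finset (Fin n)))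
    (he : ∀ C ∈ Fam, (#(verts C \ verts Y) : ℝ) - outerCost b C (verts Y) ≤ e) :
    ∑ C ∈ Fam, weight p (Y ∪ C) ≤
      weight p Y * (2 ^ 2 ^ M * 2 ^ #(verts Y) * 3 * (n : ℝ) ^ e) := by
  have hn0 : (0 : ℝ) < n := by exact_mod_cast hn
  have hn1 : (1 : ℝ) ≤ n := by exact_mod_cast hn
  have h1 : ∀ C ∈ Fam, weight p (Y ∪ C) ≤
      weight p Y * ((n : ℝ) ^ e * ((n : ℝ)⁻¹) ^ #(verts C \ verts Y)) := by
    intro C hC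
    refine (weight_union_le hp hn Y (hJ C hC)).trans
      (mul_le_mul_of_nonneg_left ?_ (weight_nonneg p Y))
    rw [inv_pow, ← Real.rpow_natCast, ← Real.rpow_neg hn0.le, ← Real.rpow_add hn0]
    exact Real.rpow_le_rpow_of_exponent_le hn1 (by linarith [he C hC])
  refine (sum_le_sum h1).trans ?_
  rw [← mul_sum, ← mul_sum]
  refine mul_le_mul_of_nonneg_left ?_ (weight_nonneg p Y)
  rw [mul_comm ((n : ℝ) ^ e)]
  refine mul_le_mul_of_nonneg_right ?_ (by positivity)
  calc ∑ C ∈ Fam, ((n : ℝ)⁻¹) ^ #(verts C \ verts Y)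
      = ∑ T : Finset (Fin n), ∑ C ∈ Fam with verts C = T, ((n : ℝ)⁻¹) ^ #(verts C \ verts Y) :=
        (sum_fiberwise_of_maps_to (fun _ _ => mem_univ _) _).symm
    _ ≤ ∑ T : Finset (Fin n), 2 ^ 2 ^ M * ((n : ℝ)⁻¹) ^ #(T \ verts Y) := by
        refine sum_le_sum fun T _ => ?_
        rw [sum_congr rfl (g := fun _ => ((n : ℝ)⁻¹) ^ #(T \ verts Y)) fun C hC => by
          rw [(mem_filter.1 hC).2], sum_const, nsmul_eq_mul]
        refine mul_le_mul_of_nonneg_right ?_ (by positivity)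
        rcases (Fam.filter fun C => verts C = T).eq_empty_or_nonempty with h0 | ⟨C₀, hC₀⟩
        · rw [h0]; simp
        · have hT : #T ≤ M := by
            rw [mem_filter] at hC₀
            rw [← hC₀.2]; exact hM _ hC₀.1
          have h2 : {C ∈ Fam | verts C = T} ⊆ T.powerset.powerset := by
            intro C hC
            rw [mem_filter] at hC
            exact mem_powerset.2 fun F hF => mem_powerset.2 (hC.2 ▸ subset_verts hF)
          have h3 := card_le_card h2
          rw [card_powerset, card_powerset] at h3
          have h4 : 2 ^ 2 ^ #T ≤ 2 ^ 2 ^ M :=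
            Nat.pow_le_pow_right (by norm_num) (Nat.pow_le_pow_right (by norm_num) hT)
          exact_mod_cast h3.trans h4
    _ ≤ 2 ^ 2 ^ M * 2 ^ #(verts Y) * 3 := by
        rw [← mul_sum, mul_assoc]
        exact mul_le_mul_of_nonneg_left (sum_inv_pow_card_sdiff_le _) (by positivity)

/-- The constant of the moment bound. -/
def momentConst (M L r : ℕ) : ℝ := (2 ^ 2 ^ M * 2 ^ (L + r * M) * 3) ^ r

theorem momentConst_nonneg (M L r : ℕ) : 0 ≤ momentConst M L r := by
  unfold momentConst; positivity

/-- Expand one factor of the power at a time: each adds a family `C` to the configuration `Y`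
already present, at a price of `n ^ e` whatever the overlap. The set `U₀` lets the exponent bound be
required only for used sets containing it, as needed for families known to meet `U₀`. -/
theorem integral_ind_mul_pow_le (hp : ∀ j ≤ J, faceProb p j = (n : ℝ) ^ (-b j)) (hn : 0 < n)
    {M : ℕ} {e : ℝ} (Fam : Finset (Finset (Finset (Fin n)))) (hJ : ∀ C ∈ Fam, ∀ F ∈ C, #F ≤ J)
    (hM : ∀ C ∈ Fam, #(verts C) ≤ M) (U₀ : Finset (Fin n))
    (he : ∀ C ∈ Fam, ∀ U, U₀ ⊆ U → (#(verts C \ U) : ℝ) - outerCost b C U ≤ e) (r : ℕ) :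
    ∀ (L : ℕ) (Y : Finset (Finset (Fin n))), U₀ ⊆ verts Y → #(verts Y) ≤ L →
      ∫ c, ind Y c * (∑ C ∈ Fam, ind C c) ^ r ∂coinLaw n p ≤
        weight p Y * (momentConst M L r * ((n : ℝ) ^ e) ^ r) := by
  induction r with
  | zero => intro L Y _ _; simp [integral_ind, momentConst]
  | succ r ih =>
    intro L Y hUY hYL
    have h1 : ∀ c : Finset (Fin n) → Bool, ind Y c * (∑ C ∈ Fam, ind C c) ^ (r + 1) =
        ∑ C ∈ Fam, ind (Y ∪ C) c * (∑ C ∈ Fam, ind C c) ^ r := by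
      intro c
      simp_rw [ind_union]
      rw [← sum_mul, ← mul_sum]; ring
    simp_rw [h1]
    rw [integral_finsetSum _ fun _ _ => integrable_coinLaw p _]
    have h2 : ∀ C ∈ Fam, ∫ c, ind (Y ∪ C) c * (∑ C ∈ Fam, ind C c) ^ r ∂coinLaw n p ≤
        weight p (Y ∪ C) * (momentConst M (L + M) r * ((n : ℝ) ^ e) ^ r) := by
      intro C hC
      refine ih (L + M) (Y ∪ C) ?_ ?_
      · rw [verts_union]; exact hUY.trans subset_union_left
      · rw [verts_union]
        -- Each factor uses up to `M` more vertices, whence `L + M` in the induction hypothesis and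
        -- `L + r * M` in `momentConst`.
        exact (card_union_le _ _).trans (add_le_add hYL (hM C hC))
    refine (sum_le_sum h2).trans ?_
    rw [← sum_mul]
    have h3 := sum_weight_union_le hp hn Fam hJ hM Y fun C hC => he C hC _ hUY
    refine (mul_le_mul_of_nonneg_right h3
      (mul_nonneg (momentConst_nonneg _ _ _) (by positivity))).trans ?_
    rw [mul_assoc]
    refine mul_le_mul_of_nonneg_left ?_ (weight_nonneg p Y)
    have h4 : (2 : ℝ) ^ #(verts Y) ≤ 2 ^ (L + (r + 1) * M) :=
      pow_le_pow_right₀ one_le_two (by omega)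
    have h5 : (L + M) + r * M = L + (r + 1) * M := by ring
    unfold momentConst
    rw [h5]
    calc 2 ^ 2 ^ M * 2 ^ #(verts Y) * 3 * (n : ℝ) ^ e *
          ((2 ^ 2 ^ M * 2 ^ (L + (r + 1) * M) * 3) ^ r * ((n : ℝ) ^ e) ^ r)
        ≤ 2 ^ 2 ^ M * 2 ^ (L + (r + 1) * M) * 3 * (n : ℝ) ^ e *
          ((2 ^ 2 ^ M * 2 ^ (L + (r + 1) * M) * 3) ^ r * ((n : ℝ) ^ e) ^ r) := by gcongr
      _ = _ := by ring

end Moments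

/-! ### Centered moments of the number of present families. -/

section Centered

open Finset

/-- A graph without isolated vertices has a dominating set of at most half its vertices. -/
theorem exists_dominating {ι : Type*} [Fintype ι] [DecidableEq ι] (R : ι → ι → Prop)
    (hsymm : ∀ i j, R i j → R j i) (hR : ∀ i, ∃ j, j ≠ i ∧ R i j) :
    ∃ D : Finset ι, 2 * #D ≤ Fintype.card ι ∧ ∀ i ∉ D, ∃ j ∈ D, R i j := by
  classical
  obtain ⟨D, hD, hmin⟩ := exists_min_image
    {D : Finset ι | ∀ i ∉ D, ∃ j ∈ D, R i j} card ⟨univ, by simp⟩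
  simp only [mem_filter, mem_univ, true_and] at hD hmin
  refine ⟨D, ?_, hD⟩
  -- A vertex of `D` with no neighbour in the complement could be removed from `D`, since it has a
  -- neighbour within `D`. So the complement of a minimal dominating set dominates too, and the
  -- smaller of the two has at most half the vertices.
  have hc : ∀ i ∉ Dᶜ, ∃ j ∈ Dᶜ, R i j := by
    intro i hi
    rw [mem_compl, not_not] at hi
    by_contra! hcon
    have hlt := hmin (D.erase i) fun x hx => by
      by_cases hxi : x = i
      · subst hxi
        obtain ⟨j, hj, hRj⟩ := hR x
        refine ⟨j, mem_erase.2 ⟨hj, ?_⟩, hRj⟩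
        by_contra hjD
        exact hcon j (mem_compl.2 hjD) hRj
      · have hxD : x ∉ D := fun h => hx (mem_erase.2 ⟨hxi, h⟩)
        obtain ⟨j, hj, hRj⟩ := hD x hxD
        refine ⟨j, mem_erase.2 ⟨fun h => ?_, hj⟩, hRj⟩
        exact hcon x (mem_compl.2 hxD) (hsymm _ _ (h ▸ hRj))
    rw [card_erase_of_mem hi] at hlt
    have := card_pos.2 ⟨i, hi⟩
    omega
  have := hmin Dᶜ hc
  rw [card_compl] at this
  have := card_le_univ D
  omega

theorem exists_perm_dominating {r : ℕ} (R : Fin r ⊕ Fin r → Fin r ⊕ Fin r → Prop)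
    (hsymm : ∀ i j, R i j → R j i) (hR : ∀ i, ∃ j, j ≠ i ∧ R i j) :
    ∃ σ : Equiv.Perm (Fin r ⊕ Fin r), ∀ j, ∃ i, R (σ (.inr j)) (σ (.inl i)) := by
  classical
  obtain ⟨D₀, hD₀, hdom₀⟩ := exists_dominating R hsymm hR
  have hcard : Fintype.card (Fin r ⊕ Fin r) = 2 * r := by simp; ring
  obtain ⟨D, hDD, hD⟩ := exists_superset_card_eq (s := D₀) (n := r) (by omega) (by omega)
  have hdom : ∀ i ∉ D, ∃ j ∈ D, R i j := fun i hi => by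
    obtain ⟨j, hj, h⟩ := hdom₀ i fun h => hi (hDD h)
    exact ⟨j, hDD hj, h⟩
  have h1 : Fintype.card {x // x ∈ D} = r := by simp [hD]
  have h2 : Fintype.card {x // ¬ x ∈ D} = r := by
    rw [Fintype.card_subtype_compl, h1, hcard]; omega
  let e₁ : Fin r ≃ {x // x ∈ D} := (Fintype.equivFinOfCardEq h1).symm
  let e₂ : Fin r ≃ {x // ¬ x ∈ D} := (Fintype.equivFinOfCardEq h2).symm
  refine ⟨(Equiv.sumCongr e₁ e₂).trans (Equiv.sumCompl (· ∈ D)), fun j => ?_⟩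
  obtain ⟨x, hx, hRx⟩ := hdom (e₂ j) (e₂ j).2
  exact ⟨e₁.symm ⟨x, hx⟩, by simpa using hRx⟩

variable {n : ℕ} (p : ℕ → unitInterval)

theorem verts_biUnion {ι : Type*} [DecidableEq ι] (s : Finset ι)
    (g : ι → Finset (Finset (Fin n))) : verts (s.biUnion g) = s.biUnion fun i => verts (g i) := by
  ext v; simp only [mem_verts, mem_biUnion]; grind

/-- If `f i` shares no vertex with the other families, its centered indicator is independent of the
remaining factors and has mean zero. Independence is verified term by term after expanding those
factors. -/
theorem integral_prod_centered_eq_zero {ι : Type*} [Fintype ι] [DecidableEq ι]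
    (f : ι → Finset (Finset (Fin n))) (i : ι)
    (hi : ∀ j, j ≠ i → Disjoint (verts (f i)) (verts (f j))) :
    ∫ c, ∏ j, (ind (f j) c - weight p (f j)) ∂coinLaw n p = 0 := by
  have h1 : ∀ c : Finset (Fin n) → Bool, ∏ j, (ind (f j) c - weight p (f j)) =
      ∑ t ∈ (univ.erase i).powerset, (ind (f i ∪ t.biUnion f) c -
        weight p (f i) * ind (t.biUnion f) c) * ∏ j ∈ univ.erase i \ t, -weight p (f j) := by
    intro c
    rw [← mul_prod_erase univ _ (mem_univ i)]
    simp_rw [sub_eq_add_neg (ind (f _) c) (weight p (f _))]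
    rw [prod_add, mul_sum]
    refine sum_congr rfl fun t _ => ?_
    rw [ind_union, ind_biUnion]; ring
  simp_rw [h1]
  rw [integral_finsetSum _ fun _ _ => integrable_coinLaw p _]
  refine sum_eq_zero fun t ht => ?_
  rw [integral_mul_const, integral_sub (integrable_coinLaw p _) (integrable_coinLaw p _),
    integral_const_mul, integral_ind, integral_ind, weight_union_of_disjoint, sub_self, zero_mul]
  rw [verts_biUnion, disjoint_biUnion_right]
  exact fun j hj => hi j (mem_erase.1 (mem_powerset.1 ht hj)).1

/-- Bound each factor by the sum of indicator and weight, expand, and use positive correlation on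
each of the `2 ^ card ι` terms. -/
theorem integral_prod_centered_le {ι : Type*} [Fintype ι] [DecidableEq ι]
    (f : ι → Finset (Finset (Fin n))) :
    ∫ c, ∏ j, (ind (f j) c - weight p (f j)) ∂coinLaw n p ≤
      2 ^ Fintype.card ι * weight p (univ.biUnion f) := by
  calc ∫ c, ∏ j, (ind (f j) c - weight p (f j)) ∂coinLaw n p
      ≤ ∫ c, ∑ t ∈ univ.powerset, ind (t.biUnion f) c * ∏ j ∈ univ \ t, weight p (f j)
          ∂coinLaw n p := by
        refine integral_mono (integrable_coinLaw p _) (integrable_coinLaw p _) fun c => ?_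
        simp_rw [ind_biUnion]
        rw [← prod_add]
        refine (le_abs_self _).trans ?_
        rw [abs_prod]
        refine prod_le_prod (fun _ _ => abs_nonneg _) fun j _ => ?_
        rw [abs_le]
        have := ind_nonneg (f j) c
        have := weight_nonneg p (f j)
        constructor <;> linarith
    _ ≤ ∑ t ∈ (univ : Finset ι).powerset, weight p (univ.biUnion f) := by
        rw [integral_finsetSum _ fun _ _ => integrable_coinLaw p _]
        refine sum_le_sum fun t _ => ?_
        rw [integral_mul_const, integral_ind]
        refine (mul_le_mul_of_nonneg_left (prod_weight_le p _ f) (weight_nonneg p _)).trans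
          ((weight_mul_le p _ _).trans_eq ?_)
        rw [← union_biUnion, union_sdiff_of_subset (subset_univ t)]
    _ = 2 ^ Fintype.card ι * weight p (univ.biUnion f) := by
        rw [sum_const, card_powerset, card_univ, nsmul_eq_mul]; simp

open Classical in
theorem sum_ind_dominated_eq (Fam : Finset (Finset (Finset (Fin n)))) (r : ℕ)
    (c : Finset (Fin n) → Bool) :
    ∑ f ∈ Fintype.piFinset fun _ : Fin r ⊕ Fin r => Fam with
        ∀ j, ∃ i, ¬ Disjoint (verts (f (.inr j))) (verts (f (.inl i))),
      ind (univ.biUnion f) c =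
    ∑ g ∈ Fintype.piFinset (fun _ : Fin r => Fam), ∑ h ∈ Fintype.piFinset (fun _ : Fin r =>
      {C ∈ Fam | ¬ Disjoint (verts C) (verts (univ.biUnion g))}),
        ind (univ.biUnion g) c * ∏ j, ind (h j) c := by
  rw [sum_sigma']
  refine sum_nbij' (fun f => ⟨fun i => f (.inl i), fun j => f (.inr j)⟩)
    (fun x => Sum.elim x.1 x.2) ?_ ?_ ?_ ?_ ?_
  · intro f hf
    simp only [mem_filter, Fintype.mem_piFinset] at hf
    simp only [mem_sigma, mem_filter, Fintype.mem_piFinset]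
    refine ⟨fun i => hf.1 _, fun j => ⟨hf.1 _, ?_⟩⟩
    obtain ⟨i, hi⟩ := hf.2 j
    rw [verts_biUnion, disjoint_biUnion_right]
    exact fun h => hi (h i (mem_univ i))
  · intro x hx
    simp only [mem_sigma, mem_filter, Fintype.mem_piFinset] at hx
    simp only [mem_filter, Fintype.mem_piFinset]
    refine ⟨fun i => ?_, fun j => ?_⟩
    · rcases i with i | i
      · exact hx.1 i
      · exact (hx.2 i).1
    · have h := (hx.2 j).2
      rw [verts_biUnion, disjoint_biUnion_right] at h
      push Not at h
      obtain ⟨i, _, hi⟩ := h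
      exact ⟨i, hi⟩
  · intro f _
    funext i
    rcases i with i | i <;> rfl
  · intro x _
    rfl
  · intro f _
    rw [ind_biUnion, ind_biUnion, Fintype.prod_sum_type]

variable {p} {b : ℕ → ℝ} {J : ℕ}

-- Fix the first `r` families. Each of the others meets their vertices and so pays only `n ^ (e -
-- δ)`; summing over the first `r` then costs `n ^ e` each.
open Classical in
theorem sum_weight_dominated_le (hp : ∀ j ≤ J, faceProb p j = (n : ℝ) ^ (-b j)) (hn : 0 < n)
    {M : ℕ} {e δ : ℝ} (Fam : Finset (Finset (Finset (Fin n))))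
    (hJ : ∀ C ∈ Fam, ∀ F ∈ C, #F ≤ J) (hM : ∀ C ∈ Fam, #(verts C) ≤ M)
    (he : ∀ C ∈ Fam, ∀ U, (#(verts C \ U) : ℝ) - outerCost b C U ≤ e)
    (he' : ∀ C ∈ Fam, ∀ U, (verts C ∩ U).Nonempty →
      (#(verts C \ U) : ℝ) - outerCost b C U ≤ e - δ) (r : ℕ) :
    ∑ f ∈ Fintype.piFinset fun _ : Fin r ⊕ Fin r => Fam with
        ∀ j, ∃ i, ¬ Disjoint (verts (f (.inr j))) (verts (f (.inl i))),
      weight p (univ.biUnion f) ≤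
    momentConst M 0 r * ((n : ℝ) ^ e) ^ r *
      (momentConst M (r * M) r * ((n : ℝ) ^ (e - δ)) ^ r) := by
  simp_rw [← integral_ind p]
  rw [← integral_finsetSum _ fun _ _ => integrable_coinLaw p _]
  simp_rw [sum_ind_dominated_eq]
  rw [integral_finsetSum _ fun _ _ => integrable_coinLaw p _]
  have h1 : ∀ g ∈ Fintype.piFinset fun _ : Fin r => Fam,
      ∫ c, ∑ h ∈ Fintype.piFinset fun _ : Fin r =>
        {C ∈ Fam | ¬ Disjoint (verts C) (verts (univ.biUnion g))},
          ind (univ.biUnion g) c * ∏ j, ind (h j) c ∂coinLaw n p ≤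
      weight p (univ.biUnion g) * (momentConst M (r * M) r * ((n : ℝ) ^ (e - δ)) ^ r) := by
    intro g hg
    rw [Fintype.mem_piFinset] at hg
    simp_rw [← mul_sum]
    have hpow : ∀ c : Finset (Fin n) → Bool, ∑ h ∈ Fintype.piFinset (fun _ : Fin r =>
        {C ∈ Fam | ¬ Disjoint (verts C) (verts (univ.biUnion g))}), ∏ j, ind (h j) c =
        (∑ C ∈ Fam with ¬ Disjoint (verts C) (verts (univ.biUnion g)), ind C c) ^ r :=
      fun c => (sum_pow' _ (fun C => ind C c) r).symm
    simp_rw [hpow]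
    refine integral_ind_mul_pow_le hp hn _ (fun C hC => hJ C (mem_filter.1 hC).1)
      (fun C hC => hM C (mem_filter.1 hC).1) (verts (univ.biUnion g)) ?_ r _ _ subset_rfl ?_
    · intro C hC U hU
      rw [mem_filter] at hC
      obtain ⟨x, hx, hx'⟩ := not_disjoint_iff.1 hC.2
      exact he' C hC.1 U ⟨x, mem_inter.2 ⟨hx, hU hx'⟩⟩
    · rw [verts_biUnion]
      refine card_biUnion_le.trans ((sum_le_card_nsmul _ _ M fun i _ => hM _ (hg i)).trans ?_)
      simp
  refine (sum_le_sum h1).trans ?_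
  rw [← sum_mul]
  refine mul_le_mul_of_nonneg_right ?_ (mul_nonneg (momentConst_nonneg _ _ _) (by positivity))
  have h2 := integral_ind_mul_pow_le hp hn Fam hJ hM ∅ (fun C hC U _ => he C hC U) r 0 ∅
    (empty_subset _) (by simp [verts])
  simp_rw [ind_empty, one_mul, sum_pow'] at h2
  rw [weight_empty, one_mul, integral_finsetSum _ fun _ _ => integrable_coinLaw p _] at h2
  refine (sum_congr rfl fun g _ => ?_).trans_le h2
  rw [← integral_ind]
  simp_rw [ind_biUnion]

/-- The constant of the bound on centered moments. -/
def centeredConst (M r : ℕ) : ℝ :=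
  2 ^ (2 * r) * ((2 * r).factorial * (momentConst M 0 r * momentConst M (r * M) r))

/-- Only tuples in which every family meets another one contribute. By `exists_perm_dominating` such
a tuple can be reordered so that each family in its second half meets one in its first half. Summing
over all reorderings gives the factor `(2 * r)!`, and at least half the families lose `δ`. -/
theorem integral_centered_pow_le (hp : ∀ j ≤ J, faceProb p j = (n : ℝ) ^ (-b j)) (hn : 0 < n)
    {M : ℕ} {e δ : ℝ} (Fam : Finset (Finset (Finset (Fin n))))
    (hJ : ∀ C ∈ Fam, ∀ F ∈ C, #F ≤ J) (hM : ∀ C ∈ Fam, #(verts C) ≤ M)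
    (he : ∀ C ∈ Fam, ∀ U, (#(verts C \ U) : ℝ) - outerCost b C U ≤ e)
    (he' : ∀ C ∈ Fam, ∀ U, (verts C ∩ U).Nonempty →
      (#(verts C \ U) : ℝ) - outerCost b C U ≤ e - δ) (r : ℕ) :
    ∫ c, (∑ C ∈ Fam, ind C c - ∑ C ∈ Fam, weight p C) ^ (2 * r) ∂coinLaw n p ≤
      centeredConst M r * (((n : ℝ) ^ e) ^ r * ((n : ℝ) ^ (e - δ)) ^ r) := by
  classical
  have hcard : Fintype.card (Fin r ⊕ Fin r) = 2 * r := by simp; ring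
  have h1 : ∀ c : Finset (Fin n) → Bool,
      (∑ C ∈ Fam, ind C c - ∑ C ∈ Fam, weight p C) ^ (2 * r) =
      ∑ f ∈ Fintype.piFinset fun _ : Fin r ⊕ Fin r => Fam,
        ∏ j, (ind (f j) c - weight p (f j)) := by
    intro c
    rw [← sum_sub_distrib, ← hcard, ← card_univ, ← prod_const,
      prod_univ_sum (fun _ => Fam) fun _ C => ind C c - weight p C]
  simp_rw [h1]
  rw [integral_finsetSum _ fun _ _ => integrable_coinLaw p _]
  set A : Finset (Fin r ⊕ Fin r → Finset (Finset (Fin n))) :=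
    Fintype.piFinset fun _ : Fin r ⊕ Fin r => Fam with hA
  set Good : (Fin r ⊕ Fin r → Finset (Finset (Fin n))) → Prop := fun f =>
    ∀ j, ∃ i, ¬ Disjoint (verts (f (.inr j))) (verts (f (.inl i))) with hGood
  have h2 : ∀ f ∈ A, ∫ c, ∏ j, (ind (f j) c - weight p (f j)) ∂coinLaw n p ≤
      ∑ σ : Equiv.Perm (Fin r ⊕ Fin r), if Good (f ∘ σ) then
        2 ^ (2 * r) * weight p (univ.biUnion (f ∘ σ)) else 0 := by
    intro f _
    have hnn : ∀ σ ∈ (univ : Finset (Equiv.Perm (Fin r ⊕ Fin r))), 0 ≤ if Good (f ∘ σ) then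
        2 ^ (2 * r) * weight p (univ.biUnion (f ∘ σ)) else 0 := by
      intro σ _
      split_ifs
      · exact mul_nonneg (by positivity) (weight_nonneg p _)
      · exact le_rfl
    by_cases hiso : ∃ i, ∀ j, j ≠ i → Disjoint (verts (f i)) (verts (f j))
    · obtain ⟨i, hi⟩ := hiso
      rw [integral_prod_centered_eq_zero p f i hi]
      exact sum_nonneg hnn
    · push Not at hiso
      obtain ⟨σ, hσ⟩ := exists_perm_dominating
        (fun i j => ¬ Disjoint (verts (f i)) (verts (f j))) (fun i j h h' => h h'.symm) hiso
      refine le_trans ?_ (single_le_sum hnn (mem_univ σ))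
      rw [if_pos (show Good (f ∘ σ) from hσ)]
      refine (integral_prod_centered_le p f).trans_eq ?_
      rw [hcard]
      congr 2
      ext F
      simp only [mem_biUnion, mem_univ, true_and, Function.comp]
      exact (σ.exists_congr_right (q := fun i => F ∈ f i)).symm
  refine (sum_le_sum h2).trans ?_
  rw [sum_comm]
  have h3 : ∀ σ : Equiv.Perm (Fin r ⊕ Fin r), (∑ f ∈ A, if Good (f ∘ σ) then
        2 ^ (2 * r) * weight p (univ.biUnion (f ∘ σ)) else 0) =
      2 ^ (2 * r) * ∑ f ∈ A with Good f, weight p (univ.biUnion f) := by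
    intro σ
    rw [mul_sum, sum_filter]
    refine sum_nbij' (fun f => f ∘ σ) (fun f => f ∘ σ.symm) ?_ ?_ ?_ ?_ ?_
    · intro f hf
      rw [hA, Fintype.mem_piFinset] at hf ⊢
      exact fun i => hf _
    · intro f hf
      rw [hA, Fintype.mem_piFinset] at hf ⊢
      exact fun i => hf _
    · intro f _; funext i; simp
    · intro f _; funext i; simp
    · intro f _; rfl
  simp_rw [h3]
  rw [sum_const, card_univ, Fintype.card_perm, hcard, nsmul_eq_mul]
  have h4 := sum_weight_dominated_le hp hn Fam hJ hM he he' r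
  refine (mul_le_mul_of_nonneg_left (mul_le_mul_of_nonneg_left h4 (by positivity))
    (Nat.cast_nonneg _)).trans_eq ?_
  unfold centeredConst; ring

end Centered

/-! ### Chains on all finite vertex sets, and supports of cycles. -/

section TotalChains

open Finset

variable {V : Type*} [LinearOrder V] (𝕜 : Type*) [Field 𝕜] (K : AbstractSimplicialComplex V)

/-- Chains of `K` as finitely supported functions on all finite sets of vertices. -/
noncomputable def toTotal (d : ℕ) : Chain 𝕜 K d →ₗ[𝕜] (Finset V →₀ 𝕜) :=
  Finsupp.lmapDomain 𝕜 𝕜 Subtype.val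

/-- The boundary map on finitely supported functions on finite sets of vertices. -/
noncomputable def totalBoundary : (Finset V →₀ 𝕜) →ₗ[𝕜] (Finset V →₀ 𝕜) :=
  Finsupp.linearCombination 𝕜 fun s : Finset V =>
    ∑ v ∈ s, Finsupp.single (s.erase v) ((-1 : 𝕜) ^ #{u ∈ s | u < v})

omit [LinearOrder V] in
theorem toTotal_single (d : ℕ) (F : Face K d) (a : 𝕜) :
    toTotal 𝕜 K d (Finsupp.single F a) = Finsupp.single F.1 a := by
  simp [toTotal, Finsupp.mapDomain_single]

omit [LinearOrder V] in
theorem toTotal_injective (d : ℕ) : Function.Injective (toTotal 𝕜 K d) :=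
  Finsupp.mapDomain_injective Subtype.val_injective

omit [LinearOrder V] in
theorem mem_of_toTotal_ne_zero {d : ℕ} {z : Chain 𝕜 K d} {F : Finset V}
    (h : toTotal 𝕜 K d z F ≠ 0) : F ∈ K ∧ #F = d + 1 := by
  by_contra hF
  refine h (Finsupp.mapDomain_of_notMem_range z F ?_)
  rintro ⟨G, rfl⟩
  exact hF G.2

theorem totalBoundary_single (s : Finset V) (a : 𝕜) :
    totalBoundary 𝕜 (Finsupp.single s a) =
      ∑ v ∈ s, Finsupp.single (s.erase v) (a * (-1 : 𝕜) ^ #{u ∈ s | u < v}) := by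
  simp [totalBoundary, Finsupp.linearCombination_single, smul_sum]

theorem toTotal_boundary (d : ℕ) (z : Chain 𝕜 K (d + 1)) :
    toTotal 𝕜 K d (boundary 𝕜 K d z) = totalBoundary 𝕜 (toTotal 𝕜 K (d + 1) z) := by
  induction z using Finsupp.induction_linear with
  | zero => simp
  | add x y hx hy => simp [hx, hy]
  | single F a =>
    rw [toTotal_single, totalBoundary_single, boundary, Finsupp.linearCombination_single,
      map_smul, map_sum, smul_sum, ← sum_attach F.1]
    refine sum_congr rfl fun v _ => ?_
    rw [toTotal_single, Finsupp.smul_single, smul_eq_mul]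
    rfl

/-- Deleting the smaller vertex `u` shifts the position of `v` by one, whereas deleting `v` leaves
the position of `u` unchanged. This sign cancels the two orders of deletion. -/
theorem neg_one_pow_mul_neg_one_pow_erase {s : Finset V} {u v : V} (hu : u ∈ s) (huv : u < v) :
    (-1 : 𝕜) ^ #{w ∈ s | w < v} * (-1 : 𝕜) ^ #{w ∈ s.erase v | w < u} =
      -((-1 : 𝕜) ^ #{w ∈ s | w < u} * (-1 : 𝕜) ^ #{w ∈ s.erase u | w < v}) := by
  have h1 : {w ∈ s.erase v | w < u} = {w ∈ s | w < u} := by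
    ext w
    simp only [mem_filter, mem_erase]
    exact ⟨fun h => ⟨h.1.2, h.2⟩, fun h => ⟨⟨(h.2.trans huv).ne, h.1⟩, h.2⟩⟩
  have h2 : #{w ∈ s | w < v} = #{w ∈ s.erase u | w < v} + 1 := by
    rw [filter_erase, card_erase_add_one (mem_filter.2 ⟨hu, huv⟩)]
  rw [h1, h2, pow_succ]; ring

theorem totalBoundary_totalBoundary (x : Finset V →₀ 𝕜) :
    totalBoundary 𝕜 (totalBoundary 𝕜 x) = 0 := by
  induction x using Finsupp.induction_linear with
  | zero => simp
  | add x y hx hy => simp [hx, hy]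
  | single s a =>
    rw [totalBoundary_single, map_sum]
    simp_rw [totalBoundary_single]
    rw [sum_sigma']
    have hmem : ∀ x : (_ : V) × V, x ∈ s.sigma (fun v => s.erase v) ↔
        x.1 ∈ s ∧ x.2 ∈ s ∧ x.2 ≠ x.1 := fun x => by
      simp only [mem_sigma, mem_erase]; tauto
    refine sum_involution (fun x _ => ⟨x.2, x.1⟩) ?_ ?_ ?_ ?_
    · rintro ⟨v, u⟩ hx
      obtain ⟨hv, hu, hne⟩ := (hmem _).1 hx
      dsimp only at hv hu hne ⊢
      rw [erase_right_comm, ← Finsupp.single_add, mul_assoc, mul_assoc, ← mul_add]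
      rcases lt_or_gt_of_ne hne with h | h
      · rw [neg_one_pow_mul_neg_one_pow_erase 𝕜 hu h]; simp
      · rw [neg_one_pow_mul_neg_one_pow_erase 𝕜 hv h]; simp
    · rintro ⟨v, u⟩ hx _ h
      obtain ⟨hv, hu, hne⟩ := (hmem _).1 hx
      exact hne (congrArg Sigma.fst h)
    · rintro ⟨v, u⟩ hx
      obtain ⟨hv, hu, hne⟩ := (hmem _).1 hx
      exact (hmem _).2 ⟨hu, hv, hne.symm⟩
    · rintro ⟨v, u⟩ _
      rfl

/-- If `F` were the only support member containing the ridge `F.erase y`, the coefficient of that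
ridge in the boundary would be plus or minus the coefficient of `F`, which is not zero. -/
theorem ridgeCyclic_support {x : Finset V →₀ 𝕜} (hx : totalBoundary 𝕜 x = 0) :
    RidgeCyclic x.support := by
  intro F hF y hy
  by_contra! hcon
  have h0 := DFunLike.congr_fun hx (F.erase y)
  rw [totalBoundary, Finsupp.linearCombination_apply, Finsupp.sum, Finsupp.finsetSum_apply,
    sum_eq_single_of_mem F hF, Finsupp.smul_apply, Finsupp.finsetSum_apply,
    sum_eq_single_of_mem y hy, Finsupp.single_eq_same] at h0
  · simp only [smul_eq_mul, Finsupp.coe_zero, Pi.zero_apply, mul_eq_zero] at h0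
    rcases h0 with h0 | h0
    · exact Finsupp.mem_support_iff.1 hF h0
    · exact pow_ne_zero _ (neg_ne_zero.2 one_ne_zero) h0
  · intro v hv hvy
    rw [Finsupp.single_apply, if_neg]
    intro h
    have : y ∈ F.erase v := mem_erase.2 ⟨hvy.symm, hy⟩
    rw [h] at this
    exact notMem_erase y F this
  · intro G hG hGF
    rw [Finsupp.smul_apply, Finsupp.finsetSum_apply, sum_eq_zero, smul_zero]
    intro v _
    rw [Finsupp.single_apply, if_neg]
    intro h
    exact hcon G hG hGF (h ▸ erase_subset _ _)

end TotalChains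

/-! ### Deterministic comparison of the Betti number with the number of hollow simplices. -/

section BettiBounds

open Finset

variable {V : Type*} [LinearOrder V] [Fintype V]

/-- The strongly connected ridge-cyclic families of `m`-faces other than the boundaries of
`(m + 1)`-simplices. -/
structure IsBadFamily (m : ℕ) (C : Finset (Finset V)) : Prop where
  card_eq : ∀ F ∈ C, #F = m + 1
  nonempty : C.Nonempty
  stronglyConnected : StronglyConnected m C
  ridgeCyclic : RidgeCyclic C
  card_verts : m + 3 ≤ #(verts C)

open Classical in
/-- The bad families on at most `M` vertices. -/
noncomputable def badFamilies (V : Type*) [LinearOrder V] [Fintype V] (m M : ℕ) :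
    Finset (Finset (Finset V)) :=
  {C | IsBadFamily m C ∧ #(verts C) ≤ M}

open Classical in
/-- The strongly connected families of `m`-faces on exactly `M + 1` vertices. -/
noncomputable def largeFamilies (V : Type*) [LinearOrder V] [Fintype V] (m M : ℕ) :
    Finset (Finset (Finset V)) :=
  {C | (∀ F ∈ C, #F = m + 1) ∧ C.Nonempty ∧ StronglyConnected m C ∧ #(verts C) = M + 1}

variable (𝕜 : Type*) [Field 𝕜] (K : AbstractSimplicialComplex V)

instance (d : ℕ) : Finite (Face K d) := Subtype.finite

open Classical in
/-- The potential `(m + 1)`-faces whose boundary is present. -/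
noncomputable def hollowSets (m : ℕ) : Finset (Finset V) :=
  {S | #S = m + 2 ∧ ∀ F ∈ powersetCard (m + 1) S, F ∈ K}

open Classical in
/-- The `(m + 1)`-faces. -/
noncomputable def filledSets (m : ℕ) : Finset (Finset V) := {S | #S = m + 2 ∧ S ∈ K}

open Classical in
/-- The `m`-faces in bad families. -/
noncomputable def badFaces (m : ℕ) : Finset (Finset V) :=
  {F | ∃ C, IsBadFamily m C ∧ (∀ G ∈ C, G ∈ K) ∧ F ∈ C}

variable {K} in
theorem mem_hollowSets {m : ℕ} {S : Finset V} : S ∈ hollowSets K m ↔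
    #S = m + 2 ∧ ∀ F ∈ powersetCard (m + 1) S, F ∈ K := by
  simp [hollowSets]

variable {K} in
theorem mem_badFaces {m : ℕ} {F : Finset V} : F ∈ badFaces K m ↔
    ∃ C, IsBadFamily m C ∧ (∀ G ∈ C, G ∈ K) ∧ F ∈ C := by
  simp [badFaces]

/-- A cycle is determined by its coefficients at one chosen facet of each hollow simplex and at all
bad faces: a component of the support of a nonzero cycle is a full hollow simplex or a bad family,
and either way contains one of the test faces. -/
theorem finrank_ker_boundary_le (d : ℕ) :
    Module.finrank 𝕜 (LinearMap.ker (boundary 𝕜 K d)) ≤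
      #(hollowSets K (d + 1)) + #(badFaces K (d + 1)) := by
  have hex : ∀ S : hollowSets K (d + 1), ∃ F, F ∈ powersetCard (d + 2) S.1 := fun S => by
    have h := (mem_hollowSets.1 S.2).1
    exact powersetCard_nonempty.2 (by omega)
  choose f hf using hex
  let pick : hollowSets K (d + 1) ⊕ badFaces K (d + 1) → Finset V := Sum.elim f Subtype.val
  let Φ : LinearMap.ker (boundary 𝕜 K d) →ₗ[𝕜]
      (hollowSets K (d + 1) ⊕ badFaces K (d + 1) → 𝕜) :=
    LinearMap.pi fun i => Finsupp.lapply (pick i) ∘ₗ toTotal 𝕜 K (d + 1) ∘ₗ Submodule.subtype _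
  have hΦ : ∀ z i, Φ z i = toTotal 𝕜 K (d + 1) z.1 (pick i) := fun _ _ => rfl
  have hinj : Function.Injective Φ := by
    rw [injective_iff_map_eq_zero]
    intro z hz
    by_contra hne
    set x := toTotal 𝕜 K (d + 1) z.1 with hx
    have hx0 : x ≠ 0 := fun h => hne (Subtype.ext (toTotal_injective 𝕜 K (d + 1) (by
      rw [← hx, h]; simp)))
    have hbd : totalBoundary 𝕜 x = 0 := by
      rw [hx, ← toTotal_boundary, LinearMap.mem_ker.1 z.2, map_zero]
    have hmem : ∀ F ∈ x.support, F ∈ K ∧ #F = d + 1 + 1 := fun F hF =>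
      mem_of_toTotal_ne_zero 𝕜 K (Finsupp.mem_support_iff.1 hF)
    have hcyc := ridgeCyclic_support 𝕜 hbd
    obtain ⟨D, hD, hDne, hDsc, hDcl⟩ := exists_component (d + 1)
      (Finsupp.support_nonempty_iff.2 hx0)
    have hDcyc := hcyc.of_closed (fun F hF => (hmem F hF).2) hD hDcl
    have hDcard : ∀ F ∈ D, #F = d + 1 + 1 := fun F hF => (hmem F (hD hF)).2
    have hge := card_verts_of_ridgeCyclic hDcard hDcyc hDne
    rcases hge.eq_or_lt with heq | hlt
    · have hDeq := hDcyc.eq_powersetCard hDcard hDne heq.symm fun F hF => subset_verts hF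
      have hS : verts D ∈ hollowSets K (d + 1) := mem_hollowSets.2 ⟨heq.symm,
        fun F hF => (hmem F (hD (hDeq.symm.subset hF))).1⟩
      have h1 := hf ⟨_, hS⟩
      have h2 : f ⟨_, hS⟩ ∈ D := hDeq.symm.subset h1
      have h3 := congrFun hz (.inl ⟨_, hS⟩)
      rw [hΦ] at h3
      exact Finsupp.mem_support_iff.1 (hD h2) h3
    · obtain ⟨F, hF⟩ := hDne
      have hFB : F ∈ badFaces K (d + 1) := mem_badFaces.2 ⟨D,
        ⟨hDcard, ⟨F, hF⟩, hDsc, hDcyc, hlt⟩, fun G hG => (hmem G (hD hG)).1, hF⟩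
      have h3 := congrFun hz (.inr ⟨F, hFB⟩)
      rw [hΦ] at h3
      exact Finsupp.mem_support_iff.1 (hD hF) h3
  have := LinearMap.finrank_le_finrank_of_injective hinj
  rw [Module.finrank_fintype_fun_eq_card] at this
  simpa using this

variable {K}

/-- The boundary of a potential `(d + 2)`-face as a chain of `K`. -/
noncomputable def hollowCycle {d : ℕ} (S : hollowSets K (d + 1)) : Chain 𝕜 K (d + 1) :=
  ∑ v ∈ S.1.attach, Finsupp.single
    (⟨S.1.erase v.1, by
      have h := mem_hollowSets.1 S.2
      have hv := erase_mem_powersetCard h.1 v.2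
      exact ⟨h.2 _ hv, (mem_powersetCard.1 hv).2⟩⟩ : Face K (d + 1))
    ((-1 : 𝕜) ^ #{u ∈ S.1 | u < v.1})

theorem toTotal_hollowCycle {d : ℕ} (S : hollowSets K (d + 1)) :
    toTotal 𝕜 K (d + 1) (hollowCycle 𝕜 S) = totalBoundary 𝕜 (Finsupp.single S.1 1) := by
  rw [hollowCycle, map_sum, totalBoundary_single, ← sum_attach S.1]
  simp_rw [toTotal_single, one_mul]

theorem boundary_hollowCycle {d : ℕ} (S : hollowSets K (d + 1)) :
    boundary 𝕜 K d (hollowCycle 𝕜 S) = 0 := by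
  refine toTotal_injective 𝕜 K d ?_
  rw [toTotal_boundary, toTotal_hollowCycle, totalBoundary_totalBoundary, map_zero]

variable (K)

open Classical in
/-- The potential `(m + 1)`-faces with present boundary which share no `m`-face with another
one. -/
noncomputable def isolatedHollowSets (m : ℕ) : Finset (Finset V) :=
  {S ∈ hollowSets K m | ∀ T ∈ hollowSets K m, T ≠ S → #(S ∩ T) < m + 1}

/-- A facet of an isolated hollow simplex belongs to no other hollow simplex, so its coefficient in
a linear combination of their boundaries detects a single term. -/
theorem card_isolatedHollowSets_le (d : ℕ) :
    #(isolatedHollowSets K (d + 1)) ≤ Module.finrank 𝕜 (LinearMap.ker (boundary 𝕜 K d)) := by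
  have hsub : ∀ S : isolatedHollowSets K (d + 1), S.1 ∈ hollowSets K (d + 1) :=
    fun S => (mem_filter.1 S.2).1
  let T : (isolatedHollowSets K (d + 1) → 𝕜) →ₗ[𝕜] Chain 𝕜 K (d + 1) :=
    Fintype.linearCombination 𝕜 fun S => hollowCycle 𝕜 ⟨S.1, hsub S⟩
  have hT : ∀ g, T g = ∑ S, g S • hollowCycle 𝕜 ⟨S.1, hsub S⟩ := fun _ => rfl
  have hker : ∀ g, T g ∈ LinearMap.ker (boundary 𝕜 K d) := fun g => by
    rw [LinearMap.mem_ker, hT, map_sum]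
    exact sum_eq_zero fun S _ => by rw [map_smul, boundary_hollowCycle, smul_zero]
  have hinj : Function.Injective (T.codRestrict _ hker) := by
    rw [injective_iff_map_eq_zero]
    intro g hg
    funext S
    have hg' : T g = 0 := congrArg Subtype.val hg
    have hS := mem_hollowSets.1 (hsub S)
    obtain ⟨y, hy⟩ : S.1.Nonempty := card_pos.1 (by omega)
    have h1 := congrArg (fun w => toTotal 𝕜 K (d + 1) w (S.1.erase y)) hg'
    simp only [hT, map_sum, map_smul, Finsupp.finsetSum_apply, Finsupp.smul_apply, map_zero,
      Finsupp.coe_zero, Pi.zero_apply, toTotal_hollowCycle, totalBoundary_single, one_mul] at h1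
    rw [sum_eq_single_of_mem S (mem_univ _), sum_eq_single_of_mem y hy, Finsupp.single_eq_same,
      smul_eq_mul, mul_eq_zero] at h1
    · exact h1.resolve_right (pow_ne_zero _ (neg_ne_zero.2 one_ne_zero))
    · intro v hv hvy
      rw [Finsupp.single_apply, if_neg]
      intro h
      have : y ∈ S.1.erase v := mem_erase.2 ⟨hvy.symm, hy⟩
      rw [h] at this
      exact notMem_erase y _ this
    · intro T _ hTS
      rw [sum_eq_zero, smul_zero]
      intro v _
      rw [Finsupp.single_apply, if_neg]
      intro h
      have h2 := (mem_filter.1 S.2).2 T.1 (hsub T) fun h => hTS (Subtype.ext h)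
      have h3 := card_le_card (subset_inter (erase_subset y S.1)
        (h ▸ erase_subset v T.1 : S.1.erase y ⊆ T.1))
      rw [card_erase_of_mem hy, hS.1] at h3
      omega
  simpa using LinearMap.finrank_le_finrank_of_injective hinj

theorem betti_succ_le (d : ℕ) :
    betti 𝕜 K (d + 1) ≤ Module.finrank 𝕜 (LinearMap.ker (boundary 𝕜 K d)) :=
  Submodule.finrank_quotient_le _

/-- The boundaries are the image of a space whose dimension is the number of filled simplices. -/
theorem finrank_ker_boundary_le_betti_add (d : ℕ) :
    Module.finrank 𝕜 (LinearMap.ker (boundary 𝕜 K d)) ≤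
      betti 𝕜 K (d + 1) + #(filledSets K (d + 1)) := by
  have h1 := Submodule.finrank_quotient_add_finrank (R := 𝕜) (M := cycles 𝕜 K (d + 1))
    ((boundaries 𝕜 K (d + 1)).submoduleOf (cycles 𝕜 K (d + 1)))
  have h2 : Module.finrank 𝕜 ((boundaries 𝕜 K (d + 1)).submoduleOf (cycles 𝕜 K (d + 1))) ≤
      Module.finrank 𝕜 (boundaries 𝕜 K (d + 1)) := by
    refine LinearMap.finrank_le_finrank_of_injective
      (f := ((cycles 𝕜 K (d + 1)).subtype.comp (Submodule.subtype _)).codRestrict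
        (boundaries 𝕜 K (d + 1)) fun x => x.2) ?_
    intro x y hxy
    have h := congrArg Subtype.val hxy
    exact Subtype.ext (Subtype.ext h)
  have h3 : Module.finrank 𝕜 (boundaries 𝕜 K (d + 1)) ≤ #(filledSets K (d + 1)) := by
    classical
    have := Fintype.ofFinite (Face K (d + 1 + 1))
    refine (LinearMap.finrank_range_le _).trans ?_
    rw [Module.finrank_finsupp_self, filledSets]
    refine (Fintype.card_of_subtype _ fun s => ?_).le
    simp [and_comm]
  change betti 𝕜 K (d + 1) + _ = Module.finrank 𝕜 (LinearMap.ker (boundary 𝕜 K d)) at h1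
  omega

open Classical in
/-- The Betti number is the number of potential faces with present boundary, up to faces and
bad families. -/
theorem abs_betti_sub_card_hollowSets_le (d M : ℕ) (hM : d + 4 ≤ M)
    (hlarge : ∀ C ∈ largeFamilies V (d + 1) M, ¬ ∀ F ∈ C, F ∈ K) :
    |(betti 𝕜 K (d + 1) : ℝ) - #(hollowSets K (d + 1))| ≤
      2 ^ M * #{C ∈ badFamilies V (d + 1) M | ∀ F ∈ C, F ∈ K} + #(filledSets K (d + 1)) := by
  set Bad := {C ∈ badFamilies V (d + 1) M | ∀ F ∈ C, F ∈ K} with hBad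
  have hBadM : ∀ C ∈ Bad, 2 ^ #(verts C) ≤ 2 ^ M := fun C hC =>
    Nat.pow_le_pow_right (by norm_num) (mem_filter.1 (mem_filter.1 hC).1).2.2
  -- A bad family on more than `M` vertices would contain a strongly connected one on exactly `M +
  -- 1`, which `hlarge` forbids. The others have at most `2 ^ M` faces each.
  have h1 : #(badFaces K (d + 1)) ≤ #Bad * 2 ^ M := by
    refine (card_le_card (t := Bad.biUnion id) fun F hF => ?_).trans
      (card_biUnion_le_card_mul _ _ _ fun C hC => ?_)
    · obtain ⟨C, hC, hCK, hFC⟩ := mem_badFaces.1 hF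
      refine mem_biUnion.2 ⟨C, mem_filter.2 ⟨mem_filter.2 ⟨mem_univ _, hC, ?_⟩, hCK⟩, hFC⟩
      by_contra! hlt
      obtain ⟨D, hDC, hD, hDsc, hDv⟩ := exists_stronglyConnected_card_verts_eq hC.card_eq
        hC.stronglyConnected hC.nonempty (by omega) hlt
      exact hlarge D (mem_filter.2 ⟨mem_univ _, fun F hF => hC.card_eq F (hDC hF), hD, hDsc, hDv⟩)
        fun F hF => hCK F (hDC hF)
    · refine le_trans ?_ (hBadM C hC)
      rw [← card_powerset]
      exact card_le_card fun F hF => mem_powerset.2 (subset_verts hF)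
  -- Two hollow simplices sharing a facet form together a bad family on `d + 4` vertices; this is
  -- where `d + 4 ≤ M` enters.
  have h2 : #(hollowSets K (d + 1)) ≤ #(isolatedHollowSets K (d + 1)) + #Bad * 2 ^ M := by
    have h3 : hollowSets K (d + 1) ⊆
        isolatedHollowSets K (d + 1) ∪ Bad.biUnion fun C => (verts C).powerset := by
      intro S hS
      by_cases hiso : S ∈ isolatedHollowSets K (d + 1)
      · exact mem_union_left _ hiso
      refine mem_union_right _ ?_
      obtain ⟨T, hT, hTS, hcard⟩ : ∃ T ∈ hollowSets K (d + 1), T ≠ S ∧ d + 1 + 1 ≤ #(S ∩ T) := by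
        by_contra! hcon
        exact hiso (mem_filter.2 ⟨hS, hcon⟩)
      have hS' := mem_hollowSets.1 hS
      have hT' := mem_hollowSets.1 hT
      have hlt : #(S ∩ T) < d + 1 + 2 := by
        by_contra! hge
        have h4 := eq_of_subset_of_card_le (inter_subset_left (s₁ := S) (s₂ := T)) (by omega)
        have h5 := eq_of_subset_of_card_le (inter_subset_right (s₁ := S) (s₂ := T)) (by omega)
        exact hTS (h5.symm.trans h4)
      have hun := card_union_add_card_inter S T
      have hv : verts (powersetCard (d + 1 + 1) S ∪ powersetCard (d + 1 + 1) T) = S ∪ T := by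
        rw [verts_union, verts_powersetCard hS'.1, verts_powersetCard hT'.1]
      have hF : S ∩ T ∈ powersetCard (d + 1 + 1) S :=
        mem_powersetCard.2 ⟨inter_subset_left, by omega⟩
      have hF' : S ∩ T ∈ powersetCard (d + 1 + 1) T :=
        mem_powersetCard.2 ⟨inter_subset_right, by omega⟩
      refine mem_biUnion.2 ⟨powersetCard (d + 1 + 1) S ∪ powersetCard (d + 1 + 1) T,
        mem_filter.2 ⟨mem_filter.2 ⟨mem_univ _, ⟨?_, ?_, ?_, ?_, ?_⟩, ?_⟩, ?_⟩, ?_⟩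
      · intro F hF
        rcases mem_union.1 hF with h | h <;> exact (mem_powersetCard.1 h).2
      · exact ⟨_, mem_union_left _ hF⟩
      · exact (stronglyConnected_powersetCard hS'.1).union (stronglyConnected_powersetCard hT'.1)
          hF hF'
      · exact (ridgeCyclic_powersetCard hS'.1).union (ridgeCyclic_powersetCard hT'.1)
      · rw [hv]; omega
      · rw [hv]; omega
      · intro F hF
        rcases mem_union.1 hF with h | h
        · exact hS'.2 F h
        · exact hT'.2 F h
      · rw [hv]; exact mem_powerset.2 subset_union_left
    refine (card_le_card h3).trans ((card_union_le _ _).trans (Nat.add_le_add_left ?_ _))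
    exact card_biUnion_le_card_mul _ _ _ fun C hC => by rw [card_powerset]; exact hBadM C hC
  have h3 := finrank_ker_boundary_le 𝕜 K d
  have h4 := card_isolatedHollowSets_le 𝕜 K d
  have h5 := betti_succ_le 𝕜 K d
  have h6 := finrank_ker_boundary_le_betti_add 𝕜 K d
  have h7 : betti 𝕜 K (d + 1) ≤ #(hollowSets K (d + 1)) + #Bad * 2 ^ M := by omega
  have h8 : #(hollowSets K (d + 1)) ≤
      betti 𝕜 K (d + 1) + #(filledSets K (d + 1)) + #Bad * 2 ^ M := by omega
  have h7' : (betti 𝕜 K (d + 1) : ℝ) ≤ #(hollowSets K (d + 1)) + #Bad * 2 ^ M := by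
    exact_mod_cast h7
  have h8' : (#(hollowSets K (d + 1)) : ℝ) ≤
      betti 𝕜 K (d + 1) + #(filledSets K (d + 1)) + #Bad * 2 ^ M := by exact_mod_cast h8
  have h9 : (0 : ℝ) ≤ #(filledSets K (d + 1)) := Nat.cast_nonneg _
  rw [abs_le]
  constructor <;> linarith

end BettiBounds

/-! ### Tail bounds of order `n ^ (-2)`. -/

section Tails

open Finset

variable {n : ℕ} {p : ℕ → unitInterval} {b : ℕ → ℝ} {J : ℕ}

theorem rpow_sub_pow_le (hn : 0 < n) {e δ : ℝ} {r : ℕ} (hr : 2 ≤ δ * r) :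
    ((n : ℝ) ^ (e - δ)) ^ r ≤ ((n : ℝ) ^ e) ^ r * ((n : ℝ) ^ 2)⁻¹ := by
  have hn0 : (0 : ℝ) < n := by exact_mod_cast hn
  have hn1 : (1 : ℝ) ≤ n := by exact_mod_cast hn
  rw [sub_eq_add_neg, Real.rpow_add hn0, mul_pow]
  refine mul_le_mul_of_nonneg_left ?_ (by positivity)
  rw [← Real.rpow_natCast _ r, ← Real.rpow_mul hn0.le, ← Real.rpow_natCast (n : ℝ) 2,
    ← Real.rpow_neg hn0.le]
  exact Real.rpow_le_rpow_of_exponent_le hn1 (by push_cast; linarith)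

/-- Markov's inequality for the `r`-th power: each factor gains `n ^ (-δ)`, and `δ * r ≥ 2` makes
the total gain at least `n ^ (-2)`. -/
theorem measureReal_count_le (hp : ∀ j ≤ J, faceProb p j = (n : ℝ) ^ (-b j)) (hn : 0 < n)
    {M : ℕ} {e δ : ℝ} (Fam : Finset (Finset (Finset (Fin n))))
    (hJ : ∀ C ∈ Fam, ∀ F ∈ C, #F ≤ J) (hM : ∀ C ∈ Fam, #(verts C) ≤ M)
    (he : ∀ C ∈ Fam, ∀ U, (#(verts C \ U) : ℝ) - outerCost b C U ≤ e - δ)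
    {r : ℕ} (hr : 2 ≤ δ * r) {ε : ℝ} (hε : 0 < ε) :
    (coinLaw n p).real {c | ε ≤ (∑ C ∈ Fam, ind C c) / (n : ℝ) ^ e} ≤
      momentConst M 0 r / ε ^ r * ((n : ℝ) ^ 2)⁻¹ := by
  have hn0 : (0 : ℝ) < n := by exact_mod_cast hn
  have hpos : (0 : ℝ) < (ε * (n : ℝ) ^ e) ^ r := by positivity
  have h1 := integral_ind_mul_pow_le hp hn Fam hJ hM ∅ (fun C hC U _ => he C hC U) r 0 ∅
    (empty_subset _) (by simp [verts])
  simp_rw [ind_empty, one_mul] at h1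
  rw [weight_empty, one_mul] at h1
  have hsum : ∀ c : Finset (Fin n) → Bool, 0 ≤ ∑ C ∈ Fam, ind C c :=
    fun c => sum_nonneg fun C _ => ind_nonneg C c
  have h2 := mul_meas_ge_le_integral_of_nonneg (μ := coinLaw n p)
    (f := fun c => (∑ C ∈ Fam, ind C c) ^ r)
    (Eventually.of_forall fun c => pow_nonneg (hsum c) r)
    (integrable_coinLaw p _) ((ε * (n : ℝ) ^ e) ^ r)
  have h3 : (coinLaw n p).real {c | ε ≤ (∑ C ∈ Fam, ind C c) / (n : ℝ) ^ e} ≤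
      (coinLaw n p).real {c | (ε * (n : ℝ) ^ e) ^ r ≤ (∑ C ∈ Fam, ind C c) ^ r} := by
    refine measureReal_mono fun c hc => ?_
    rw [Set.mem_ofPred_eq, le_div_iff₀ (by positivity)] at hc
    exact pow_le_pow_left₀ (by positivity) hc r
  have h4 := rpow_sub_pow_le hn (e := e) hr
  refine h3.trans ?_
  rw [← mul_le_mul_iff_of_pos_left hpos]
  refine (h2.trans h1).trans ((mul_le_mul_of_nonneg_left h4 (momentConst_nonneg _ _ _)).trans_eq ?_)
  field_simp
  ring

theorem measureReal_abs_count_sub_le (hp : ∀ j ≤ J, faceProb p j = (n : ℝ) ^ (-b j)) (hn : 0 < n)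
    {M : ℕ} {e δ : ℝ} (Fam : Finset (Finset (Finset (Fin n))))
    (hJ : ∀ C ∈ Fam, ∀ F ∈ C, #F ≤ J) (hM : ∀ C ∈ Fam, #(verts C) ≤ M)
    (he : ∀ C ∈ Fam, ∀ U, (#(verts C \ U) : ℝ) - outerCost b C U ≤ e)
    (he' : ∀ C ∈ Fam, ∀ U, (verts C ∩ U).Nonempty →
      (#(verts C \ U) : ℝ) - outerCost b C U ≤ e - δ)
    {r : ℕ} (hr : 2 ≤ δ * r) {ε : ℝ} (hε : 0 < ε) :
    (coinLaw n p).real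
        {c | ε ≤ |∑ C ∈ Fam, ind C c - ∑ C ∈ Fam, weight p C| / (n : ℝ) ^ e} ≤
      centeredConst M r / ε ^ (2 * r) * ((n : ℝ) ^ 2)⁻¹ := by
  have hn0 : (0 : ℝ) < n := by exact_mod_cast hn
  have hpos : (0 : ℝ) < (ε * (n : ℝ) ^ e) ^ (2 * r) := by positivity
  have h1 := integral_centered_pow_le hp hn Fam hJ hM he he' r
  have h2 := mul_meas_ge_le_integral_of_nonneg (μ := coinLaw n p)
    (f := fun c => (∑ C ∈ Fam, ind C c - ∑ C ∈ Fam, weight p C) ^ (2 * r))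
    (Eventually.of_forall fun c => (even_two_mul r).pow_nonneg _)
    (integrable_coinLaw p _) ((ε * (n : ℝ) ^ e) ^ (2 * r))
  have h3 : (coinLaw n p).real
        {c | ε ≤ |∑ C ∈ Fam, ind C c - ∑ C ∈ Fam, weight p C| / (n : ℝ) ^ e} ≤
      (coinLaw n p).real {c | (ε * (n : ℝ) ^ e) ^ (2 * r) ≤
        (∑ C ∈ Fam, ind C c - ∑ C ∈ Fam, weight p C) ^ (2 * r)} := by
    refine measureReal_mono fun c hc => ?_
    rw [Set.mem_ofPred_eq, le_div_iff₀ (by positivity)] at hc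
    rw [Set.mem_ofPred_eq, ← (even_two_mul r).pow_abs (∑ C ∈ Fam, ind C c - _)]
    exact pow_le_pow_left₀ (by positivity) hc _
  have h4 := rpow_sub_pow_le hn (e := e) hr
  have h5 : 0 ≤ centeredConst M r := by
    have := momentConst_nonneg M 0 r
    have := momentConst_nonneg M (r * M) r
    unfold centeredConst; positivity
  refine h3.trans ?_
  rw [← mul_le_mul_iff_of_pos_left hpos]
  refine (h2.trans h1).trans ((mul_le_mul_of_nonneg_left (mul_le_mul_of_nonneg_left h4
    (by positivity)) h5).trans_eq ?_)
  field_simp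
  ring

/-- The first moment suffices here, so only exponents relative to the empty set are needed. -/
theorem measureReal_count_le_of_exponent_le_neg_two
    (hp : ∀ j ≤ J, faceProb p j = (n : ℝ) ^ (-b j)) (hn : 0 < n)
    {M : ℕ} (Fam : Finset (Finset (Finset (Fin n))))
    (hJ : ∀ C ∈ Fam, ∀ F ∈ C, #F ≤ J) (hM : ∀ C ∈ Fam, #(verts C) ≤ M)
    (he : ∀ C ∈ Fam, (#(verts C) : ℝ) - outerCost b C ∅ ≤ -2) {ε : ℝ} (hε : 0 < ε) :
    (coinLaw n p).real {c | ε ≤ ∑ C ∈ Fam, ind C c} ≤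
      2 ^ 2 ^ M * 3 / ε * ((n : ℝ) ^ 2)⁻¹ := by
  have h0 : verts (∅ : Finset (Finset (Fin n))) = ∅ := by simp [verts]
  have h1 := sum_weight_union_le hp hn Fam hJ hM ∅ (e := -2) (by simpa [h0] using he)
  simp only [empty_union, weight_empty, h0, card_empty, pow_zero, mul_one, one_mul] at h1
  have h2 := mul_meas_ge_le_integral_of_nonneg (μ := coinLaw n p)
    (f := fun c => ∑ C ∈ Fam, ind C c)
    (Eventually.of_forall fun c => sum_nonneg fun C _ => ind_nonneg C c)
    (integrable_coinLaw p _) ε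
  rw [integral_finsetSum _ fun _ _ => integrable_coinLaw p _] at h2
  simp_rw [integral_ind] at h2
  rw [← mul_le_mul_iff_of_pos_left hε]
  refine (h2.trans h1).trans_eq ?_
  rw [Real.rpow_neg (Nat.cast_nonneg n), ← Nat.cast_ofNat (R := ℝ) (n := 2), Real.rpow_natCast]
  field_simp

end Tails

/-! ### Almost sure convergence by Borel–Cantelli. -/

section AlmostSure

/-- Almost sure convergence to zero from summable tails, whatever the joint law. -/
theorem ae_tendsto_zero {Ω : Type*} [MeasurableSpace Ω] {P : Measure Ω}
    {p : ℕ → ℕ → unitInterval} {X : (n : ℕ) → Ω → AbstractSimplicialComplex (Fin n)}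
    (hX : ∀ n, HasLaw (X n) (complexLaw n (p n)) P)
    (Z : (n : ℕ) → AbstractSimplicialComplex (Fin n) → ℝ) (hZ : ∀ n K, 0 ≤ Z n K)
    (h : ∀ ε > 0, ∃ A : ℝ, ∀ n > 0,
      (coinLaw n (p n)).real {c | ε ≤ Z n (complexOfCoins c)} ≤ A * ((n : ℝ) ^ 2)⁻¹) :
    ∀ᵐ ω ∂P, Tendsto (fun n => Z n (X n ω)) atTop (𝓝 0) := by
  have key : ∀ j : ℕ, ∀ᵐ ω ∂P, ∀ᶠ n in atTop, Z n (X n ω) < 1 / ((j : ℝ) + 1) := by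
    intro j
    obtain ⟨A, hA⟩ := h (1 / ((j : ℝ) + 1)) (by positivity)
    have hP : ∀ n, P {ω | 1 / ((j : ℝ) + 1) ≤ Z n (X n ω)} =
        ENNReal.ofReal ((coinLaw n (p n)).real
          {c | 1 / ((j : ℝ) + 1) ≤ Z n (complexOfCoins c)}) := by
      intro n
      rw [(hX n).measure_eq (p := fun K => 1 / ((j : ℝ) + 1) ≤ Z n K) MeasurableSpace.measurableSet_top,
        ofReal_measureReal, complexLaw,
        Measure.map_apply (measurable_of_countable _) MeasurableSpace.measurableSet_top]
      rfl
    have hsum : Summable fun n => (coinLaw n (p n)).real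
        {c | 1 / ((j : ℝ) + 1) ≤ Z n (complexOfCoins c)} := by
      refine Summable.of_norm_bounded_eventually_nat
        ((Real.summable_nat_pow_inv.2 one_lt_two).mul_left A) ?_
      filter_upwards [eventually_gt_atTop 0] with n hn
      rw [Real.norm_of_nonneg measureReal_nonneg]
      exact hA n hn
    have h1 := ae_eventually_notMem (μ := P)
      (s := fun n => {ω | 1 / ((j : ℝ) + 1) ≤ Z n (X n ω)}) (by
        simp_rw [hP]; exact hsum.tsum_ofReal_ne_top)
    filter_upwards [h1] with ω hω
    filter_upwards [hω] with n hn
    exact not_le.1 hn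
  filter_upwards [ae_all_iff.2 key] with ω hω
  rw [Metric.tendsto_atTop']
  intro ε hε
  obtain ⟨j, hj⟩ := exists_nat_one_div_lt hε
  obtain ⟨N, hN⟩ := eventually_atTop.1 (hω j)
  refine ⟨N, fun n hn => ?_⟩
  rw [Real.dist_eq, sub_zero, abs_of_nonneg (hZ _ _)]
  exact (hN n hn.le).trans hj

end AlmostSure

/-! ### Face counts as sums of indicators, and the mean number of hollow simplices. -/

section Counting

open Finset

variable {n : ℕ}

theorem mem_complexOfCoins {c : Finset (Fin n) → Bool} {s : Finset (Fin n)} :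
    s ∈ complexOfCoins c ↔ s.Nonempty ∧ ∀ t ⊆ s, 2 ≤ #t → c t = true := Iff.rfl

theorem present_iff {C : Finset (Finset (Fin n))} (hC : ∀ F ∈ C, F.Nonempty)
    (c : Finset (Fin n) → Bool) : Present C c ↔ ∀ F ∈ C, F ∈ complexOfCoins c := by
  simp only [Present, mem_subfaces, mem_complexOfCoins]
  exact ⟨fun h F hF => ⟨hC F hF, fun t ht h2 => h t ⟨F, hF, ht⟩ h2⟩,
    fun h s ⟨F, hF, hs⟩ h2 => (h F hF).2 s hs h2⟩

open Classical in
theorem card_filter_eq_sum_ind {Fam : Finset (Finset (Finset (Fin n)))}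
    (hF : ∀ C ∈ Fam, ∀ F ∈ C, F.Nonempty) (c : Finset (Fin n) → Bool) :
    (#{C ∈ Fam | ∀ F ∈ C, F ∈ complexOfCoins c} : ℝ) = ∑ C ∈ Fam, ind C c := by
  rw [← sum_boole]
  refine sum_congr rfl fun C hC => ?_
  simp only [ind, present_iff (hF C hC)]

/-- The boundaries of the potential `(m + 1)`-faces. -/
def hollowFamilies (n m : ℕ) : Finset (Finset (Finset (Fin n))) :=
  (powersetCard (m + 2) univ).image (powersetCard (m + 1))

/-- The potential `(m + 1)`-faces, as families with one member. -/
def simplexFamilies (n m : ℕ) : Finset (Finset (Finset (Fin n))) :=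
  (powersetCard (m + 2) univ).image singleton

theorem injOn_powersetCard (m : ℕ) : Set.InjOn (powersetCard (m + 1))
    (powersetCard (m + 2) (univ : Finset (Fin n)) : Set (Finset (Fin n))) := by
  intro S hS T hT h
  rw [← verts_powersetCard (mem_powersetCard.1 hS).2, h,
    verts_powersetCard (mem_powersetCard.1 hT).2]

theorem mem_hollowFamilies {m : ℕ} {C : Finset (Finset (Fin n))} :
    C ∈ hollowFamilies n m ↔ ∃ S, #S = m + 2 ∧ powersetCard (m + 1) S = C := by
  simp [hollowFamilies]

theorem mem_simplexFamilies {m : ℕ} {C : Finset (Finset (Fin n))} :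
    C ∈ simplexFamilies n m ↔ ∃ S, #S = m + 2 ∧ {S} = C := by
  simp [simplexFamilies]

theorem card_hollowSets_eq (m : ℕ) (c : Finset (Fin n) → Bool) :
    (#(hollowSets (complexOfCoins c) m) : ℝ) = ∑ C ∈ hollowFamilies n m, ind C c := by
  classical
  rw [← card_filter_eq_sum_ind, hollowFamilies, filter_image, card_image_of_injOn]
  · congr 2; ext S; simp [hollowSets]
  · exact (injOn_powersetCard m).mono (by gcongr; exact filter_subset _ _)
  · intro C hC F hF
    obtain ⟨S, _, rfl⟩ := mem_hollowFamilies.1 hC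
    exact card_pos.1 (by rw [(mem_powersetCard.1 hF).2]; omega)

theorem card_filledSets_eq (m : ℕ) (c : Finset (Fin n) → Bool) :
    (#(filledSets (complexOfCoins c) m) : ℝ) = ∑ C ∈ simplexFamilies n m, ind C c := by
  classical
  rw [← card_filter_eq_sum_ind, simplexFamilies, filter_image,
    card_image_of_injOn singleton_injective.injOn]
  · congr 2; ext S; simp [filledSets]
  · intro C hC F hF
    obtain ⟨S, hS, rfl⟩ := mem_simplexFamilies.1 hC
    rw [mem_singleton.1 hF]
    exact card_pos.1 (by omega)

theorem sum_subfaces_powersetCard (b : ℕ → ℝ) {m : ℕ} {S : Finset (Fin n)} (hS : #S = m + 2) :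
    ∑ s ∈ subfaces (powersetCard (m + 1) S), b #s = simplexCost b (m + 2) - b (m + 2) := by
  have h : subfaces (powersetCard (m + 1) S) = S.powerset.erase S := by
    ext s
    simp only [mem_subfaces, mem_erase, mem_powerset]
    refine ⟨fun ⟨F, hF, hs⟩ => ⟨fun h => ?_, hs.trans (mem_powersetCard.1 hF).1⟩,
      fun ⟨hne, hs⟩ => ?_⟩
    · have := card_le_card hs
      rw [(mem_powersetCard.1 hF).2, h, hS] at this
      omega
    · obtain ⟨x, hxS, hxs⟩ := exists_of_ssubset (hs.ssubset_of_ne hne)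
      exact ⟨S.erase x, erase_mem_powersetCard hS hxS, subset_erase.2 ⟨hs, hxs⟩⟩
  rw [h, eq_sub_iff_add_eq, ← hS, ← sum_powerset_cost b S]
  exact sum_erase_add _ _ (mem_powerset_self S)

theorem sum_weight_hollowFamilies {p : ℕ → unitInterval} {b : ℕ → ℝ} {k m : ℕ} {e : ℝ}
    (h : CostData b k m e) (hp : ∀ j ≤ m + 2, faceProb p j = (n : ℝ) ^ (-b j)) (hn : 0 < n) :
    ∑ C ∈ hollowFamilies n m, weight p C = (n.choose (m + 2) : ℝ) / (n : ℝ) ^ (m + 2) *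
      (n : ℝ) ^ e := by
  have hn0 : (0 : ℝ) < n := by exact_mod_cast hn
  rw [hollowFamilies, sum_image (injOn_powersetCard m)]
  rw [sum_congr rfl (g := fun _ => ((n : ℝ) ^ (m + 2))⁻¹ * (n : ℝ) ^ e) fun S hS => ?_, sum_const,
    card_powersetCard, card_univ, Fintype.card_fin, nsmul_eq_mul]
  · ring
  · have hS' := (mem_powersetCard.1 hS).2
    rw [weight_eq_rpow hp hn fun F hF => by rw [(mem_powersetCard.1 hF).2]; omega,
      sum_subfaces_powersetCard b hS', ← Real.rpow_natCast, ← Real.rpow_neg hn0.le,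
      ← Real.rpow_add hn0, h.exponent]
    congr 1; push_cast; ring

theorem tendsto_choose_div_pow (j : ℕ) :
    Tendsto (fun n : ℕ => (n.choose j : ℝ) / (n : ℝ) ^ j) atTop (𝓝 (1 / (j.factorial : ℝ))) := by
  have h := isEquivalent_choose j
  rw [Asymptotics.isEquivalent_iff_tendsto_one] at h
  · have h2 := h.mul_const (1 / (j.factorial : ℝ))
    rw [one_mul] at h2
    refine h2.congr' ?_
    filter_upwards [eventually_gt_atTop 0] with n hn
    have hn0 : (0 : ℝ) < n := by exact_mod_cast hn
    have : (0 : ℝ) < j.factorial := by exact_mod_cast j.factorial_pos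
    simp only [Pi.div_apply]
    field_simp
  · filter_upwards [eventually_gt_atTop 0] with n hn
    have hn0 : (0 : ℝ) < n := by exact_mod_cast hn
    have : (0 : ℝ) < j.factorial := by exact_mod_cast j.factorial_pos
    positivity

end Counting

/-! ### Almost sure limits of the counts and of the Betti number. -/

section Convergence

open Finset

variable {Ω : Type*} [MeasurableSpace Ω] {P : Measure Ω} {p : ℕ → ℕ → unitInterval}
  {X : (n : ℕ) → Ω → AbstractSimplicialComplex (Fin n)} {b : ℕ → ℝ} {k m : ℕ} {e : ℝ}

open Classical in
theorem ae_tendsto_card_badFamilies (hX : ∀ n, HasLaw (X n) (complexLaw n (p n)) P)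
    (h : CostData b k m e)
    (hp : ∀ n, 0 < n → ∀ j ≤ m + 2, faceProb (p n) j = (n : ℝ) ^ (-b j)) (M : ℕ) :
    ∀ᵐ ω ∂P, Tendsto (fun n : ℕ => (#{C ∈ badFamilies (Fin n) m M | ∀ F ∈ C, F ∈ X n ω} : ℝ) /
      (n : ℝ) ^ e) atTop (𝓝 0) := by
  refine ae_tendsto_zero hX (fun n K => (#{C ∈ badFamilies (Fin n) m M | ∀ F ∈ C, F ∈ K} : ℝ) /
    (n : ℝ) ^ e) (fun n K => by positivity) fun ε hε => ?_
  obtain ⟨r, hr⟩ := exists_nat_ge (2 / CostData.gap b m e)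
  rw [div_le_iff₀' h.gap_pos] at hr
  refine ⟨momentConst M 0 r / ε ^ r, fun n hn => ?_⟩
  have hbad : ∀ C ∈ badFamilies (Fin n) m M, IsBadFamily m C ∧ #(verts C) ≤ M := fun C hC => by
    simpa [badFamilies] using hC
  have hcard : ∀ C ∈ badFamilies (Fin n) m M, ∀ F ∈ C, #F = m + 1 :=
    fun C hC => (hbad C hC).1.card_eq
  simp_rw [card_filter_eq_sum_ind fun C hC F hF => card_pos.1 (by
    rw [hcard C hC F hF]; omega)]
  refine measureReal_count_le (hp n hn) hn _ (fun C hC F hF => by rw [hcard C hC F hF]; omega)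
    (fun C hC => (hbad C hC).2) (fun C hC U => ?_) hr hε
  have hB := (hbad C hC).1
  exact h.exponent_le_sub_gap hB.card_eq hB.nonempty hB.stronglyConnected hB.ridgeCyclic
    hB.card_verts U

theorem ae_tendsto_card_filledSets (hX : ∀ n, HasLaw (X n) (complexLaw n (p n)) P)
    (h : CostData b k m e) (hbm : 0 < b (m + 2))
    (hp : ∀ n, 0 < n → ∀ j ≤ m + 2, faceProb (p n) j = (n : ℝ) ^ (-b j)) :
    ∀ᵐ ω ∂P, Tendsto (fun n : ℕ => (#(filledSets (X n ω) m) : ℝ) / (n : ℝ) ^ e)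
      atTop (𝓝 0) := by
  refine ae_tendsto_zero hX (fun n K => (#(filledSets K m) : ℝ) / (n : ℝ) ^ e)
    (fun n K => by positivity) fun ε hε => ?_
  have hδ : 0 < min e (b (m + 2)) := lt_min h.pos hbm
  obtain ⟨r, hr⟩ := exists_nat_ge (2 / min e (b (m + 2)))
  rw [div_le_iff₀' hδ] at hr
  refine ⟨momentConst (m + 2) 0 r / ε ^ r, fun n hn => ?_⟩
  simp_rw [card_filledSets_eq]
  refine measureReal_count_le (hp n hn) hn _ (fun C hC F hF => ?_) (fun C hC => ?_)
    (fun C hC U => ?_) hr hε <;> obtain ⟨S, hS, rfl⟩ := mem_simplexFamilies.1 hC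
  · rw [mem_singleton.1 hF, hS]
  · simp [verts, hS]
  · have := h.exponent_simplex_le hS U
    simpa [verts] using this

theorem ae_tendsto_card_hollowSets (hX : ∀ n, HasLaw (X n) (complexLaw n (p n)) P)
    (h : CostData b k m e)
    (hp : ∀ n, 0 < n → ∀ j ≤ m + 2, faceProb (p n) j = (n : ℝ) ^ (-b j)) :
    ∀ᵐ ω ∂P, Tendsto (fun n : ℕ => (#(hollowSets (X n ω) m) : ℝ) / (n : ℝ) ^ e)
      atTop (𝓝 (1 / ((m + 2).factorial : ℝ))) := by
  have h0 : ∀ᵐ ω ∂P, Tendsto (fun n : ℕ => |(#(hollowSets (X n ω) m) : ℝ) -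
      ∑ C ∈ hollowFamilies n m, weight (p n) C| / (n : ℝ) ^ e) atTop (𝓝 0) := by
    refine ae_tendsto_zero hX (fun n K => |(#(hollowSets K m) : ℝ) -
      ∑ C ∈ hollowFamilies n m, weight (p n) C| / (n : ℝ) ^ e) (fun n K => by positivity)
      fun ε hε => ?_
    obtain ⟨r, hr⟩ := exists_nat_ge (2 / CostData.gap b m e)
    rw [div_le_iff₀' h.gap_pos] at hr
    refine ⟨centeredConst (m + 2) r / ε ^ (2 * r), fun n hn => ?_⟩
    simp_rw [card_hollowSets_eq]
    refine measureReal_abs_count_sub_le (hp n hn) hn _ (fun C hC F hF => ?_) (fun C hC => ?_)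
      (fun C hC U => ?_) (fun C hC U hU => ?_) hr hε <;>
      obtain ⟨S, hS, rfl⟩ := mem_hollowFamilies.1 hC
    · rw [(mem_powersetCard.1 hF).2]; omega
    · rw [verts_powersetCard hS, hS]
    · exact h.exponent_le (fun F hF => (mem_powersetCard.1 hF).2)
        (powersetCard_nonempty.2 (by omega)) (stronglyConnected_powersetCard hS)
        (ridgeCyclic_powersetCard hS) U
    · rw [verts_powersetCard hS] at hU ⊢
      exact h.exponent_hollow_le_sub_gap hS hU
  filter_upwards [h0] with ω hω
  have h1 : Tendsto (fun n : ℕ => ((#(hollowSets (X n ω) m) : ℝ) -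
      ∑ C ∈ hollowFamilies n m, weight (p n) C) / (n : ℝ) ^ e) atTop (𝓝 0) := by
    refine squeeze_zero_norm (fun n => ?_) hω
    rw [norm_div, Real.norm_eq_abs, Real.norm_of_nonneg (by positivity)]
  have h2 := h1.add (tendsto_choose_div_pow (m + 2))
  rw [zero_add] at h2
  refine h2.congr' ?_
  filter_upwards [eventually_gt_atTop 0] with n hn
  have hn0 : (0 : ℝ) < n := by exact_mod_cast hn
  have hne : (n : ℝ) ^ e ≠ 0 := by positivity
  rw [sum_weight_hollowFamilies h (hp n hn) hn, sub_div, mul_div_cancel_right₀ _ hne]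
  ring

open Classical in
theorem exists_ae_eventually_no_largeFamilies (hX : ∀ n, HasLaw (X n) (complexLaw n (p n)) P)
    (h : CostData b k m e)
    (hp : ∀ n, 0 < n → ∀ j ≤ m + 2, faceProb (p n) j = (n : ℝ) ^ (-b j)) :
    ∃ M, m + 3 ≤ M ∧ ∀ᵐ ω ∂P, ∀ᶠ n in atTop,
      ∀ C ∈ largeFamilies (Fin n) m M, ¬ ∀ F ∈ C, F ∈ X n ω := by
  have hj : 0 < joinCost b m - 1 := by linarith [h.one_lt_joinCost]
  -- With `M = N + m + 3` a large family has `N + 3` vertices beyond its first face, so its exponent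
  -- is at most `(m + 1) - N * (joinCost b m - 1) ≤ (m + 1) - (m + 3) = -2`.
  obtain ⟨N, hN⟩ := exists_nat_ge ((m + 3) / (joinCost b m - 1))
  rw [div_le_iff₀ hj] at hN
  refine ⟨N + m + 3, by omega, ?_⟩
  have h0 : ∀ᵐ ω ∂P, Tendsto (fun n : ℕ => (#{C ∈ largeFamilies (Fin n) m (N + m + 3) |
      ∀ F ∈ C, F ∈ X n ω} : ℝ)) atTop (𝓝 0) := by
    refine ae_tendsto_zero hX (fun n K => (#{C ∈ largeFamilies (Fin n) m (N + m + 3) |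
      ∀ F ∈ C, F ∈ K} : ℝ)) (fun n K => by positivity) fun ε hε => ?_
    refine ⟨2 ^ 2 ^ (N + m + 3 + 1) * 3 / ε, fun n hn => ?_⟩
    have hlarge : ∀ C ∈ largeFamilies (Fin n) m (N + m + 3), (∀ F ∈ C, #F = m + 1) ∧ C.Nonempty ∧
        StronglyConnected m C ∧ #(verts C) = N + m + 3 + 1 := fun C hC => by
      simpa [largeFamilies] using hC
    simp_rw [card_filter_eq_sum_ind fun C hC F hF => card_pos.1 (by
      rw [(hlarge C hC).1 F hF]; omega)]
    refine measureReal_count_le_of_exponent_le_neg_two (hp n hn) hn _ (fun C hC F hF => by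
      rw [(hlarge C hC).1 F hF]; omega) (fun C hC => (hlarge C hC).2.2.2.le) (fun C hC => ?_) hε
    obtain ⟨h1, h2, h3, h4⟩ := hlarge C hC
    refine (h.exponent_stronglyConnected_le h1 h2 h3).trans ?_
    rw [h4]; push_cast; linarith
  filter_upwards [h0] with ω hω
  -- A count that tends to zero is eventually below `1`, hence zero.
  filter_upwards [hω.eventually_lt_const one_pos] with n hn C hC hCX
  have h1 : #{C ∈ largeFamilies (Fin n) m (N + m + 3) | ∀ F ∈ C, F ∈ X n ω} < 1 := by
    exact_mod_cast hn
  rw [Nat.lt_one_iff, card_eq_zero] at h1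
  exact eq_empty_iff_forall_notMem.1 h1 C (mem_filter.2 ⟨hC, hCX⟩)

theorem ae_tendsto_betti (𝕜 : Type*) [Field 𝕜]
    (hX : ∀ n, HasLaw (X n) (complexLaw n (p n)) P)
    (h : CostData b k m e) (hbm : 0 < b (m + 2))
    (hp : ∀ n, 0 < n → ∀ j ≤ m + 2, faceProb (p n) j = (n : ℝ) ^ (-b j)) :
    ∀ᵐ ω ∂P, Tendsto (fun n : ℕ => (betti 𝕜 (X n ω) m : ℝ) / (n : ℝ) ^ e)
      atTop (𝓝 (1 / ((m + 2).factorial : ℝ))) := by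
  classical
  -- Since `m > k ≥ 0`, the `m`-cycles are the kernel of a boundary map rather than the exceptional
  -- case of `0`-chains.
  obtain ⟨d, rfl⟩ : ∃ d, m = d + 1 := ⟨m - 1, by have := h.lt; omega⟩
  obtain ⟨M, hM, hlarge⟩ := exists_ae_eventually_no_largeFamilies hX h hp
  filter_upwards [hlarge, ae_tendsto_card_badFamilies hX h hp M,
    ae_tendsto_card_filledSets hX h hbm hp, ae_tendsto_card_hollowSets hX h hp]
    with ω h1 h2 h3 h4
  have h5 : Tendsto (fun n : ℕ => ((betti 𝕜 (X n ω) (d + 1) : ℝ) - #(hollowSets (X n ω) (d + 1))) /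
      (n : ℝ) ^ e) atTop (𝓝 0) := by
    have h6 := (h2.const_mul ((2 : ℝ) ^ M)).add h3
    rw [mul_zero, zero_add] at h6
    refine squeeze_zero_norm' ?_ h6
    filter_upwards [h1] with n hn
    rw [norm_div, Real.norm_eq_abs, Real.norm_of_nonneg (by positivity), ← mul_div_assoc, ← add_div]
    exact div_le_div_of_nonneg_right
      (abs_betti_sub_card_hollowSets_le 𝕜 (X n ω) d M hM hn) (by positivity)
  have h6 := h5.add h4
  rw [zero_add] at h6
  refine h6.congr fun n => ?_
  rw [sub_div]; ring

end Convergence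

/-! ### Translation from the parameters `α` to face costs. -/

section Parameters

open Finset

/-- The cost of a face with `j` vertices. -/
noncomputable def faceCost (α : ℕ → ℝ≥0∞) (j : ℕ) : ℝ := if 2 ≤ j then (α (j - 1)).toReal else 0

variable {α : ℕ → ℝ≥0∞} {m : ℕ}

theorem faceCost_nonneg (j : ℕ) : 0 ≤ faceCost α j := by
  unfold faceCost; split_ifs <;> simp

theorem faceCost_add_two (i : ℕ) : faceCost α (i + 2) = (α (i + 1)).toReal := by
  simp [faceCost]

theorem psi_ne_top (hα : ∀ i ∈ Icc 1 (m + 1), α i ≠ ∞) {j : ℕ} (hj : j ≤ m + 1) :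
    psi α j ≠ ∞ := by
  refine ENNReal.sum_ne_top.2 fun i hi => ENNReal.mul_ne_top (ENNReal.natCast_ne_top _) ?_
  rw [mem_Icc] at hi
  exact hα i (mem_Icc.2 ⟨hi.1, hi.2.trans hj⟩)

/-- The two sums differ by a shift of index and by the term `i = 0`, which vanishes because vertices
cost nothing. -/
theorem toReal_psi (hα : ∀ i ∈ Icc 1 (m + 1), α i ≠ ∞) {j : ℕ} (hj : j ≤ m + 1) :
    (psi α j).toReal = joinCost (faceCost α) j := by
  rw [psi, ENNReal.toReal_sum fun i hi => ENNReal.mul_ne_top (ENNReal.natCast_ne_top _)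
    (hα i (mem_Icc.2 ⟨(mem_Icc.1 hi).1, (mem_Icc.1 hi).2.trans hj⟩)), joinCost, sum_range_succ']
  have h0 : faceCost α (0 + 1) = 0 := by simp [faceCost]
  rw [h0, mul_zero, add_zero, range_eq_Ico, sum_Ico_add' (fun i => (j.choose i : ℝ) *
    faceCost α (i + 1))]
  refine sum_congr (by ext; simp) fun i hi => ?_
  obtain ⟨i, rfl⟩ : ∃ l, i = l + 1 := ⟨i - 1, by have := (mem_Icc.1 hi).1; omega⟩
  rw [faceCost_add_two, ENNReal.toReal_mul, ENNReal.toReal_natCast]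

theorem sum_joinCost (j : ℕ) :
    ∑ i ∈ Icc 1 j, joinCost (faceCost α) i = simplexCost (faceCost α) (j + 1) := by
  induction j with
  | zero => simp [simplexCost, sum_range_succ, faceCost]
  | succ j ih => rw [sum_Icc_succ_top (by omega), ih, simplexCost_succ _ (j + 1)]

/-- An infinite `α i` with `i ≤ m + 1` makes `ψ_{m+1}` infinite and `τ_{m+1}` equal to `⊥`. In
`EReal` a sum with `⊥` is `⊥`, even if the other term is `⊤`, so positivity excludes this. -/
theorem ne_top_of_tau_pos (h : 0 < tau α (m + 1) + (α (m + 1) : EReal)) :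
    ∀ i ∈ Icc 1 (m + 1), α i ≠ ∞ := by
  intro i hi htop
  rw [mem_Icc] at hi
  have h1 : psi α (m + 1) = ∞ := ENNReal.sum_eq_top.2 ⟨i, mem_Icc.2 hi, by
    rw [htop, ENNReal.mul_top]
    exact_mod_cast (Nat.choose_pos hi.2).ne'⟩
  have h2 : ∑ i ∈ Icc 1 (m + 1), psi α i = ∞ :=
    ENNReal.sum_eq_top.2 ⟨m + 1, by simp, h1⟩
  rw [tau, h2] at h
  simp at h

theorem tau_add_eq (hα : ∀ i ∈ Icc 1 (m + 1), α i ≠ ∞) :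
    tau α (m + 1) + (α (m + 1) : EReal) =
      (((m + 2 : ℝ) - simplexCost (faceCost α) (m + 2) + faceCost α (m + 2) : ℝ) : EReal) := by
  have h1 : ∑ i ∈ Icc 1 (m + 1), psi α i ≠ ∞ :=
    ENNReal.sum_ne_top.2 fun i hi => psi_ne_top hα (mem_Icc.1 hi).2
  have h2 : (∑ i ∈ Icc 1 (m + 1), psi α i).toReal = simplexCost (faceCost α) (m + 2) := by
    rw [ENNReal.toReal_sum fun i hi => psi_ne_top hα (mem_Icc.1 hi).2, ← sum_joinCost (m + 1)]
    exact sum_congr rfl fun i hi => toReal_psi hα (mem_Icc.1 hi).2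
  rw [tau, ← EReal.coe_ennreal_toReal h1, h2,
    ← EReal.coe_ennreal_toReal (hα (m + 1) (by simp)), ← faceCost_add_two,
    ← EReal.coe_sub, ← EReal.coe_add]
  congr 1
  push_cast; ring

theorem faceProb_connProb (hα : ∀ i ∈ Icc 1 (m + 1), α i ≠ ∞) (n : ℕ) {j : ℕ} (hj : j ≤ m + 2) :
    faceProb (fun i => connProb n (α i)) j = (n : ℝ) ^ (-faceCost α j) := by
  unfold faceProb faceCost
  split_ifs with h2
  · have : α (j - 1) ≠ ∞ := hα _ (mem_Icc.2 (by omega))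
    simp [connProb, this]
  · simp

theorem costData_faceCost {k : ℕ} (hk : IsCriticalDim α k) (hm : k + 1 ≤ m)
    (hα : ∀ i ∈ Icc 1 (m + 1), α i ≠ ∞)
    (hpos : 0 < tau α (m + 1) + (α (m + 1) : EReal)) :
    CostData (faceCost α) k m (tau α (m + 1) + (α (m + 1) : EReal)).toReal where
  nonneg := faceCost_nonneg
  zero := by simp [faceCost]
  one := by simp [faceCost]
  lt := hm
  join_lt := by
    rw [← toReal_psi hα (by omega), ← ENNReal.toReal_one]
    exact (ENNReal.toReal_lt_toReal (psi_ne_top hα (by omega)) ENNReal.one_ne_top).2 hk.psi_lt_one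
  lt_join := by
    rw [← toReal_psi hα (by omega), ← ENNReal.toReal_one]
    exact (ENNReal.toReal_lt_toReal ENNReal.one_ne_top (psi_ne_top hα (by omega))).2 hk.one_lt_psi
  exponent := by rw [tau_add_eq hα, EReal.toReal_coe]
  pos := by
    rw [tau_add_eq hα] at hpos ⊢
    rw [EReal.toReal_coe]
    exact_mod_cast hpos

end Parameters

end MultiparamComplex

theorem theorem2p1 (𝕜 : Type*) [Field 𝕜]
    {Ω : Type*} [MeasurableSpace Ω] (P : Measure Ω) [IsProbabilityMeasure P]
    (α : ℕ → ℝ≥0∞) (k m : ℕ)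
    (hk : MultiparamComplex.IsCriticalDim α k) (hm : k + 1 ≤ m)
    (hpos : 0 < MultiparamComplex.tau α (m + 1) + (α (m + 1) : EReal))
    (hα_pos : 0 < α (m + 1)) (hα_fin : α (m + 1) < ∞)
    (X : (n : ℕ) → Ω → AbstractSimplicialComplex (Fin n))
    (hX : ∀ n, HasLaw (X n)
      (MultiparamComplex.complexLaw n fun i => MultiparamComplex.connProb n (α i)) P) :
    ∀ᵐ ω ∂P, Tendsto
      (fun n : ℕ => (MultiparamComplex.betti 𝕜 (X n ω) m : ℝ) /
        (n : ℝ) ^ (MultiparamComplex.tau α (m + 1) + (α (m + 1) : EReal)).toReal)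
      atTop (𝓝 (1 / ((m + 2).factorial : ℝ))) := by
  have hα := MultiparamComplex.ne_top_of_tau_pos hpos
  refine MultiparamComplex.ae_tendsto_betti 𝕜 hX
    (MultiparamComplex.costData_faceCost hk hm hα hpos) ?_
    fun n _ j hj => MultiparamComplex.faceProb_connProb hα n hj
  rw [MultiparamComplex.faceCost_add_two]
  exact ENNReal.toReal_pos hα_pos.ne' hα_fin.ne
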